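/- **Setting.** Let $T\in\mathbb N_0\cup\{\infty\}$ and let $\mathbb T=\{0,\dots,T\}$ if $T<\infty$, and either $\mathbb T=\mathbb N_0$ or $\mathbb T=\mathbb N_0\cup\{\infty\}$ if $T=\infty$. Let $(\Omega,\mathcal F,(\mathcal F_t)_{t\in\mathbb T\cap\mathbb N_0},P)$ be a filtered probability space with $\mathcal F_0=\{\emptyset,\Omega\}$, and for $T=\infty$ put $\mathcal F_\infty=\sigma(\bigcup_{t\in\mathbb N_0}\mathcal F_t)$. If $T=\infty$, assume that each $\mathcal F_t$, $t\in\mathbb N_0$, is $\sigma$-isomorphic to the Borel $\sigma$-field of a complete separable metric space, and that $\bigcap_n A_n\neq\emptyset$ for every decreasing sequence $(A_n)_{n\in\mathbb N_0}$ such that $A_n$ is an atom of $\mathcal F_n$. Let $\mu=(\mu_t)_{t\in\mathbb T}$ be an adapted process with $\mu_t>0$ for all $t\in\mathbb T$ and $\sum_{t\in\mathbb T}\mu_t=1$. On $\bar\Omega=\Omega\times\mathbb T$ let $\bar{\mathcal F}$ be the optional $\sigma$-field, generated by the sets $A_t\times\{t\}$ with $t\in\mathbb T$ and $A_t\in\mathcal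 F_t$, and let $\bar P=P\otimes\mu$, i.e. $E_{\bar P}[X]=E_P[\sum_{t\in\mathbb T}X_t\mu_t]$. Let $\mathcal M(\bar P)$ be the set of probability measures $\bar Q\ll\bar P$ on $\bar{\mathcal F}$. (In)equalities between random variables hold $P$-a.s. unless stated otherwise. * $\mathcal R^\infty$ is the set of adapted processes $X=(X_t)_{t\in\mathbb T}$ that are bounded by a constant; $\Delta X_t=X_t-X_{t-1}$ for $t\in\mathbb T\cap\mathbb N_0$, with $X_{-1}:=0$. If $\infty\in\mathbb T$, $\mathcal X^\infty$ is the set of $X\in\mathcal R^\infty$ with $X_\infty=\lim_{t\to\infty}X_t$ $P$-a.s. * $\mathcal M_{\rm loc}(P)$ is the set of probability measures $Q$ on $(\Omega,\mathcal F_T)$ with $Q\ll P$ on $\mathcal F_t$ for each $t\in\mathbb T\cap\mathbb N_0$. For $T=\infty$ let $M_t=\frac{dQ}{dP}\big|_{\mathcal F_t}$ and $M_\infty=\lim_{t\to\infty}M_t\in[0,\infty]$, which exists $P$-a.s. and $Q$-a.s. * $\Gamma(Q)$ is the set of nonnegative adapted processes $\gamma=(\gamma_t)_{t\in\mathbb T}$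 with $\sum_{t\in\mathbb T}\gamma_t=1$ $Q$-a.s. and, if $\infty\in\mathbb T$, $\gamma_\infty=0$ $Q$-a.s. on $\{M_\infty=\infty\}$. * $\mathcal D(Q)$ is the set of predictable processes $D=(D_t)_{t\in\mathbb T}$ ($D_{t+1}$ is $\mathcal F_t$-measurable, and $D_\infty$ is $\mathcal F_\infty$-measurable if $\infty\in\mathbb T$) with $D_0=1$, $D_{t+1}\le D_t$ for $t,t+1\in\mathbb T\cap\mathbb N_0$, $D_t\ge0$ $Q$-a.s. for all $t\in\mathbb T$, and such that: if $\mathbb T=\mathbb N_0$, then $\lim_{t\to\infty}D_t=0$ $Q$-a.s.; if $\infty\in\mathbb T$, then $\lim_{t\to\infty}D_t=D_\infty$ $Q$-a.s. and $D_\infty=0$ $Q$-a.s. on $\{M_\infty=\infty\}$. A process $D$ determines $\gamma$ by $$\gamma_t=D_t-D_{t+1}\ (t\in\mathbb T\cap\mathbb N_0),\quad D_{T+1}:=0\text{ if }T<\infty,\qquad \gamma_\infty=D_\infty\ \text{ if }\infty\in\mathbb T,\tag{1}$$ and a process $\gamma$ determines $D$ by $$D_t=1-\sum_{s<t}\gamma_s\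 (t\in\mathbb T\cap\mathbb N_0),\qquad D_\infty=\gamma_\infty\ \text{ if }\infty\in\mathbb T.\tag{2}$$ Write $\bar Q=Q\otimes\gamma$ if $$E_{\bar Q}[X]=E_Q\Big[\sum_{t\in\mathbb T}\gamma_tX_t\Big]\quad\text{for all }X\in\mathcal R^\infty,$$ and $\bar Q=Q\otimes D$ if $$E_{\bar Q}[X]=E_Q\Big[\sum_{t=0}^{T}D_t\,\Delta X_t\Big]\quad\text{for all }X\in\mathcal R^\infty\text{ if }\infty\notin\mathbb T,\text{ and for all }X\in\mathcal X^\infty\text{ if }\infty\in\mathbb T.$$ Here it is part of the claim that the expectations exist, that the first sum converges absolutely $Q$-a.s., and, for $T=\infty$, that the second sum converges $Q$-a.s. as the limit of its partial sums $\sum_{t=0}^nD_t\,\Delta X_t$ as $n\to\infty$. **Theorem.** (a) For every $\bar Q\in\mathcal M(\bar P)$ there exist $Q\in\mathcal M_{\rm loc}(P)$, $\gamma\in\Gamma(Q)$ and $D\in\mathcal D(Q)$, related by (1) and with $D\ge0$ $P$-a.s., such that $\bar Q=Q\otimes\gamma=Q\otimes D$. (b) Conversely, let $Q\in\mathcal M_{\rm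 loc}(P)$. For every $\gamma\in\Gamma(Q)$ there is exactly one $\bar Q\in\mathcal M(\bar P)$ such that $\bar Q=Q\otimes\gamma=Q\otimes D$ with $D$ given by (2). For every $D\in\mathcal D(Q)$ there is exactly one $\bar Q\in\mathcal M(\bar P)$ such that $\bar Q=Q\otimes\gamma=Q\otimes D$ with $\gamma$ given by (1). -/

import Mathlib

open MeasureTheory Filter Topology
open scoped ENNReal

noncomputable section

namespace OptionalDecomposition

/-! ### Time sets and filtrations -/

/-- The three kinds of time sets: `{0, …, T}`, `ℕ₀` and `ℕ₀ ∪ {∞}`. -/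
inductive Horizon : Type
  | finite (T : ℕ)
  | nat
  | natInf

/-- The time set `𝕋`, as a set of extended natural numbers. -/
def Horizon.times : Horizon → Set ℕ∞
  | .finite T => {t | t ≤ (T : ℕ∞)}
  | .nat => {t | t ≠ ⊤}
  | .natInf => Set.univ

/-- `T = ∞`. -/
def Horizon.IsInfinite : Horizon → Prop
  | .finite _ => False
  | .nat => True
  | .natInf => True

variable {Ω : Type*} {mΩ : MeasurableSpace Ω}

/-- The σ-field at a time `t ∈ ℕ₀ ∪ {∞}`: `𝓕 t` if `t` is finite, and `𝓕_∞ = σ(⋃ₙ 𝓕 n)` if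
`t = ∞`. (For a finite horizon `T` only `𝓕 0, …, 𝓕 T` are ever used.) -/
abbrev sigmaAt (𝓕 : Filtration ℕ mΩ) (t : ℕ∞) : MeasurableSpace Ω :=
  ENat.recTopCoe (⨆ n, 𝓕 n) (fun n => 𝓕 n) t

/-- The terminal σ-field `𝓕_T`, that is `𝓕_∞` if `T = ∞`. -/
abbrev Horizon.sigma (h : Horizon) (𝓕 : Filtration ℕ mΩ) : MeasurableSpace Ω :=
  match h with
  | .finite T => 𝓕 T
  | .nat => ⨆ n, 𝓕 n
  | .natInf => ⨆ n, 𝓕 n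

theorem sigmaAt_le (𝓕 : Filtration ℕ mΩ) (t : ℕ∞) : sigmaAt 𝓕 t ≤ mΩ := by
  induction t using ENat.recTopCoe with
  | top => exact iSup_le fun n => 𝓕.le n
  | coe n => exact 𝓕.le n

/-! ### The standing assumption on the filtration for an infinite horizon -/

/-- The σ-field `m` is σ-isomorphic to the Borel σ-field of a complete separable metrizable space:
there is a bijection of the σ-fields which respects complements and countable unions. -/
def IsStandardSigmaField (m : MeasurableSpace Ω) : Prop :=
  ∃ (Y : Type) (_ : TopologicalSpace Y) (_ : PolishSpace Y)
    (e : {A : Set Ω // MeasurableSet[m] A} ≃ {B : Set Y // MeasurableSet[borel Y] B}),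
    (∀ A : {A : Set Ω // MeasurableSet[m] A}, (e ⟨(A : Set Ω)ᶜ, A.2.compl⟩ : Set Y) =
      (e A : Set Y)ᶜ) ∧
    ∀ A : ℕ → {A : Set Ω // MeasurableSet[m] A},
      (e ⟨⋃ n, (A n : Set Ω), MeasurableSet.iUnion fun n => (A n).2⟩ : Set Y) =
        ⋃ n, (e (A n) : Set Y)

/-- `A` is an atom of the σ-field `m`: a minimal nonempty element of `m`. -/
def IsSigmaAtom (m : MeasurableSpace Ω) (A : Set Ω) : Prop :=
  MeasurableSet[m] A ∧ A.Nonempty ∧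
    ∀ B : Set Ω, MeasurableSet[m] B → B ⊆ A → B = ∅ ∨ B = A

/-- Every `𝓕 t` is standard, and decreasing sequences of atoms have nonempty intersection. -/
def IsStandardFiltration (𝓕 : Filtration ℕ mΩ) : Prop :=
  (∀ t : ℕ, IsStandardSigmaField (𝓕 t)) ∧
    ∀ A : ℕ → Set Ω, (∀ n, IsSigmaAtom (𝓕 n) (A n)) → Antitone A → (⋂ n, A n).Nonempty

/-! ### Processes

A process is a function `X : ℕ∞ → Ω → ℝ`, of which only the values at times in `𝕋` matter. -/

/-- Adapted processes. -/
def IsAdapted (h : Horizon) (𝓕 : Filtration ℕ mΩ) (X : ℕ∞ → Ω → ℝ) : Prop :=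
  ∀ t ∈ h.times, Measurable[sigmaAt 𝓕 t] (X t)

/-- Predictable processes: `D 0` is `𝓕 0`-measurable, `D (t + 1)` is `𝓕 t`-measurable, and `D ∞`
is `𝓕_∞`-measurable if `∞ ∈ 𝕋`. -/
def IsPredictableProcess (h : Horizon) (𝓕 : Filtration ℕ mΩ) (D : ℕ∞ → Ω → ℝ) : Prop :=
  Measurable[𝓕 0] (D 0) ∧
    (∀ t : ℕ, ((t + 1 : ℕ) : ℕ∞) ∈ h.times → Measurable[𝓕 t] (D ((t + 1 : ℕ) : ℕ∞))) ∧
    (⊤ ∈ h.times → Measurable[sigmaAt 𝓕 ⊤] (D ⊤))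

/-- The space `𝓡^∞` of (essentially) bounded adapted processes. -/
def IsBoundedAdapted (h : Horizon) (P : Measure Ω) (𝓕 : Filtration ℕ mΩ)
    (X : ℕ∞ → Ω → ℝ) : Prop :=
  IsAdapted h 𝓕 X ∧ ∃ c : ℝ, ∀ᵐ ω ∂P, ∀ t ∈ h.times, |X t ω| ≤ c

/-- The processes for which summation by parts is claimed: all of `𝓡^∞` if `∞ ∉ 𝕋`, and the
space `𝓧^∞` of those `X ∈ 𝓡^∞` with `X ∞ = lim X t` `P`-a.s. if `∞ ∈ 𝕋`. -/
def IsConvergentBoundedAdapted (h : Horizon) (P : Measure Ω) (𝓕 : Filtration ℕ mΩ)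
    (X : ℕ∞ → Ω → ℝ) : Prop :=
  IsBoundedAdapted h P 𝓕 X ∧
    (⊤ ∈ h.times → ∀ᵐ ω ∂P, Tendsto (fun n : ℕ => X n ω) atTop (𝓝 (X ⊤ ω)))

/-- A reference process: adapted, strictly positive, of total mass one, `P`-a.s. -/
def IsReferenceProcess (h : Horizon) (P : Measure Ω) (𝓕 : Filtration ℕ mΩ)
    (μ : ℕ∞ → Ω → ℝ) : Prop :=
  IsAdapted h 𝓕 μ ∧ (∀ᵐ ω ∂P, ∀ t ∈ h.times, 0 < μ t ω) ∧
    ∀ᵐ ω ∂P, HasSum (fun t : h.times => μ t ω) 1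

/-! ### The product space -/

/-- The optional σ-field on `Ω × 𝕋`, generated by the sets `A × {t}` with `A ∈ 𝓕_t`. -/
abbrev optionalSigma (h : Horizon) (𝓕 : Filtration ℕ mΩ) : MeasurableSpace (Ω × h.times) :=
  MeasurableSpace.generateFrom
    {B | ∃ (t : h.times) (A : Set Ω), MeasurableSet[sigmaAt 𝓕 t] A ∧ B = A ×ˢ {t}}

/-- The section maps are measurable, so that the push-forwards in `refMeasure` are genuine. -/
theorem measurable_section (h : Horizon) (𝓕 : Filtration ℕ mΩ) (t : h.times) :
    @Measurable Ω (Ω × h.times) mΩ (optionalSigma h 𝓕) (fun ω => (ω, t)) := by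
  refine @measurable_generateFrom Ω (Ω × h.times) mΩ _ _ ?_
  rintro B ⟨s, A, hA, rfl⟩
  by_cases hst : t = s
  · subst hst
    have : (fun ω : Ω => (ω, t)) ⁻¹' (A ×ˢ {t}) = A := by ext; simp
    rw [this]
    exact sigmaAt_le 𝓕 t A hA
  · have : (fun ω : Ω => (ω, t)) ⁻¹' (A ×ˢ {s}) = ∅ := by ext; simp [hst]
    rw [this]
    exact MeasurableSet.empty

/-- The measure `P̄ = P ⊗ μ` on the optional σ-field, `P̄(B) = E_P[∑ₜ 1_B(·, t) μₜ]`. -/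
def refMeasure (h : Horizon) (P : Measure Ω) (𝓕 : Filtration ℕ mΩ) (μ : ℕ∞ → Ω → ℝ) :
    Measure[optionalSigma h 𝓕] (Ω × h.times) :=
  @Measure.sum (Ω × h.times) h.times (optionalSigma h 𝓕) fun t =>
    @Measure.map Ω (Ω × h.times) mΩ (optionalSigma h 𝓕) (fun ω => (ω, t))
      (P.withDensity fun ω => ENNReal.ofReal (μ t ω))

/-! ### Locally absolutely continuous measures, random measures, discounting processes -/

/-- `Q ≪ P` on `𝓕 t` for every finite `t ∈ 𝕋`. -/
def IsLocallyAC (h : Horizon) (P : Measure Ω) (𝓕 : Filtration ℕ mΩ)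
    (Q : Measure[h.sigma 𝓕] Ω) : Prop :=
  ∀ t : ℕ, (t : ℕ∞) ∈ h.times → ∀ A : Set Ω, MeasurableSet[𝓕 t] A → P A = 0 → Q A = 0

/-- The density process `M t` of `Q` with respect to `P` on `𝓕 t`, for `T = ∞`. -/
def densityProcess (P : Measure Ω) (𝓕 : Filtration ℕ mΩ) (Q : Measure[⨆ n, 𝓕 n] Ω)
    (t : ℕ) : Ω → ℝ≥0∞ :=
  (Q.trim (le_iSup (fun n => 𝓕 n) t)).rnDeriv (P.trim (𝓕.le t))

/-- `M ∞ = lim M t`. The limit exists `P`-a.s. and `Q`-a.s. in `[0, ∞]` (and is then the upper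
limit). -/
def limitDensity (P : Measure Ω) (𝓕 : Filtration ℕ mΩ) (Q : Measure[⨆ n, 𝓕 n] Ω)
    (ω : Ω) : ℝ≥0∞ :=
  limsup (fun t : ℕ => densityProcess P 𝓕 Q t ω) atTop

/-- If `𝕋 = ℕ₀ ∪ {∞}`: the random variable `g` vanishes `Q`-a.s. on `{M ∞ = ∞}`. -/
def VanishesOnSingular (h : Horizon) (P : Measure Ω) (𝓕 : Filtration ℕ mΩ)
    (Q : Measure[h.sigma 𝓕] Ω) (g : Ω → ℝ) : Prop :=
  match h, Q with
  | .finite _, _ => True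
  | .nat, _ => True
  | .natInf, Q => ∀ᵐ ω ∂Q, limitDensity P 𝓕 Q ω = ∞ → g ω = 0

/-- The set `Γ(Q)` of optional random measures on `𝕋` normalized with respect to `Q`. -/
structure IsOptionalRandomMeasure (h : Horizon) (P : Measure Ω) (𝓕 : Filtration ℕ mΩ)
    (Q : Measure[h.sigma 𝓕] Ω) (γ : ℕ∞ → Ω → ℝ) : Prop where
  adapted : IsAdapted h 𝓕 γ
  nonneg : ∀ᵐ ω ∂P, ∀ t ∈ h.times, 0 ≤ γ t ω
  hasSum : ∀ᵐ ω ∂Q, HasSum (fun t : h.times => γ t ω) 1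
  singular : VanishesOnSingular h P 𝓕 Q (γ ⊤)

/-- `D ∞ = lim D t` `Q`-a.s. if `T = ∞`, where `D ∞ = 0` in the case `𝕋 = ℕ₀`. -/
def HasDiscountLimit (h : Horizon) (𝓕 : Filtration ℕ mΩ)
    (Q : Measure[h.sigma 𝓕] Ω) (D : ℕ∞ → Ω → ℝ) : Prop :=
  match h, Q with
  | .finite _, _ => True
  | .nat, Q => ∀ᵐ ω ∂Q, Tendsto (fun n : ℕ => D n ω) atTop (𝓝 0)
  | .natInf, Q => ∀ᵐ ω ∂Q, Tendsto (fun n : ℕ => D n ω) atTop (𝓝 (D ⊤ ω))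

/-- The set `𝓓(Q)` of predictable discounting processes. -/
structure IsDiscountingProcess (h : Horizon) (P : Measure Ω) (𝓕 : Filtration ℕ mΩ)
    (Q : Measure[h.sigma 𝓕] Ω) (D : ℕ∞ → Ω → ℝ) : Prop where
  predictable : IsPredictableProcess h 𝓕 D
  zero : ∀ ω, D 0 ω = 1
  antitone : ∀ᵐ ω ∂P, ∀ t : ℕ, ((t + 1 : ℕ) : ℕ∞) ∈ h.times →
    D ((t + 1 : ℕ) : ℕ∞) ω ≤ D (t : ℕ∞) ω
  nonneg : ∀ᵐ ω ∂Q, ∀ t ∈ h.times, 0 ≤ D t ω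
  limit : HasDiscountLimit h 𝓕 Q D
  singular : VanishesOnSingular h P 𝓕 Q (D ⊤)

open Classical in
/-- `γ t = D t - D (t + 1)` for finite `t`, where `D (T + 1) = 0` if `T < ∞`, and `γ ∞ = D ∞`. -/
def discToGamma (h : Horizon) (D : ℕ∞ → Ω → ℝ) (t : ℕ∞) (ω : Ω) : ℝ :=
  D t ω - if t ≠ ⊤ ∧ t + 1 ∈ h.times then D (t + 1) ω else 0

/-- `D t = 1 - ∑_{s < t} γ s` for finite `t`, and `D ∞ = γ ∞`. -/
def gammaToDisc (γ : ℕ∞ → Ω → ℝ) (t : ℕ∞) (ω : Ω) : ℝ :=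
  ENat.recTopCoe (γ ⊤ ω) (fun n => 1 - ∑ s ∈ Finset.range n, γ (s : ℕ∞) ω) t

/-! ### The two representations -/

/-- `ΔX t = X t - X (t - 1)` with `X (-1) = 0`. -/
def increment (X : ℕ∞ → Ω → ℝ) : ℕ → Ω → ℝ
  | 0, ω => X 0 ω
  | t + 1, ω => X ((t + 1 : ℕ) : ℕ∞) ω - X (t : ℕ∞) ω

/-- `∑_{t=0}^T D t * ΔX t` exists at `ω` and equals `s`; if `T = ∞` the sum is the limit of the
partial sums (it need not converge absolutely). -/
def HasDiscountedSum (h : Horizon) (D X : ℕ∞ → Ω → ℝ) (ω : Ω) (s : ℝ) : Prop :=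
  match h with
  | .finite T => ∑ t ∈ Finset.range (T + 1), D (t : ℕ∞) ω * increment X t ω = s
  | .nat => Tendsto (fun n : ℕ => ∑ t ∈ Finset.range (n + 1), D (t : ℕ∞) ω * increment X t ω)
      atTop (𝓝 s)
  | .natInf => Tendsto (fun n : ℕ => ∑ t ∈ Finset.range (n + 1), D (t : ℕ∞) ω * increment X t ω)
      atTop (𝓝 s)

/-- `Q̄ = Q ⊗ γ`: for all `X ∈ 𝓡^∞`, `E_Q̄[X] = E_Q[∑_{t ∈ 𝕋} γ t * X t]`, where the series
converges absolutely `Q`-a.s. and both expectations exist. -/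
def IsTensorGamma (h : Horizon) (P : Measure Ω) (𝓕 : Filtration ℕ mΩ)
    (Qbar : Measure[optionalSigma h 𝓕] (Ω × h.times)) (Q : Measure[h.sigma 𝓕] Ω)
    (γ : ℕ∞ → Ω → ℝ) : Prop :=
  ∀ X : ℕ∞ → Ω → ℝ, IsBoundedAdapted h P 𝓕 X →
    Integrable (fun p : Ω × h.times => X p.2 p.1) Qbar ∧
    (∀ᵐ ω ∂Q, Summable fun t : h.times => γ t ω * X t ω) ∧
    Integrable (fun ω => ∑' t : h.times, γ t ω * X t ω) Q ∧
    ∫ p, X p.2 p.1 ∂Qbar = ∫ ω, ∑' t : h.times, γ t ω * X t ω ∂Q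

/-- `Q̄ = Q ⊗ D`: `E_Q̄[X] = E_Q[∑_{t=0}^T D t * ΔX t]` for all `X ∈ 𝓡^∞` if `∞ ∉ 𝕋`, and for all
`X ∈ 𝓧^∞` if `∞ ∈ 𝕋`; the sum exists `Q`-a.s. and both expectations exist. -/
def IsTensorDisc (h : Horizon) (P : Measure Ω) (𝓕 : Filtration ℕ mΩ)
    (Qbar : Measure[optionalSigma h 𝓕] (Ω × h.times)) (Q : Measure[h.sigma 𝓕] Ω)
    (D : ℕ∞ → Ω → ℝ) : Prop :=
  ∀ X : ℕ∞ → Ω → ℝ, IsConvergentBoundedAdapted h P 𝓕 X →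
    Integrable (fun p : Ω × h.times => X p.2 p.1) Qbar ∧
    ∃ S : Ω → ℝ, (∀ᵐ ω ∂Q, HasDiscountedSum h D X ω (S ω)) ∧ Integrable S Q ∧
      ∫ p, X p.2 p.1 ∂Qbar = ∫ ω, S ω ∂Q

end OptionalDecomposition

end

open OptionalDecomposition

open MeasureTheory Filter Topology
open scoped ENNReal

noncomputable section

namespace OptionalDecomposition

variable {Ω : Type*} {mΩ : MeasurableSpace Ω}

/-! ### Extension of consistent probability measures -/

/-! A measure on the optional σ-field is a countable family of measures, one on each `𝓕_t`, so both
directions compare sections time by time.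

Given `Q` and `γ`, the only candidate is `B ↦ E_Q[∑ 1_B(·, t) γ_t]`. It integrates bounded adapted
processes as required and is absolutely continuous once `P`-a.s. statements about time `t` hold
`Q`-a.s. where `γ_t ≠ 0`. For finite `t` this is local absolute continuity. At `∞`, `Q` may be
partly singular, but on `{M_∞ < ∞}` it is absolutely continuous with respect to `P`, and `γ_∞`
vanishes elsewhere (`IsLocallyAC.ae_eq_zero_or`). The representation by `D` follows by Abel
summation; the boundary term `D_n X_n` tends to `γ_∞ X_∞`, or to `0` if `∞ ∉ 𝕋`. Indicator processes
give uniqueness.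

Given `Q̄`, let `g_t` be the `P`-density of its section at `t`, extended by zero off `𝕋`, and `G_n =
∑_{k ≥ n} g_k + g_∞`. The nonnegative supermartingale `E[G_n | 𝓕_n]` factors as `M_n D_n` with a
martingale `M` and a decreasing predictable `D` (`exists_multiplicative_decomposition`). The
martingale is turned into a measure `Q` with density `M_n` on `𝓕_n`; for an infinite horizon it may
fail to be uniformly integrable, and `Q` comes from an extension theorem on standard filtrations
(`IsStandardFiltration.exists_extension`). For finite `t` with `t + 1 ∈ 𝕋`, `M_t (D_t - D_{t+1}) =
g_t`, so `γ_t Q = g_t P` on `𝓕_t`. Letting `n → ∞` in `D_n Q = G_n P` gives `D_∞ Q = g_∞ P` on `𝓕_∞`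
(`setLIntegral_iInf_eq`), which yields the mass at `∞`, the limit conditions on `D`, and `D_∞ = 0`
on the `P`-null set `{M_∞ = ∞}`. -/

/-- A standard σ-field is generated by a surjection onto a Polish space. -/
theorem IsStandardSigmaField.exists_surjective_eq_comap {m : MeasurableSpace Ω}
    (hm : IsStandardSigmaField m) :
    ∃ (Y : Type) (_ : MeasurableSpace Y) (_ : StandardBorelSpace Y) (φ : Ω → Y),
      Function.Surjective φ ∧ m = MeasurableSpace.comap φ inferInstance := by
  obtain ⟨Y, _, _, e, hcompl, hunion⟩ := hm
  borelize Y
  have ecompl (B : {B : Set Y // MeasurableSet B}) :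
      (e.symm ⟨(B : Set Y)ᶜ, B.2.compl⟩ : Set Ω) = (e.symm B : Set Ω)ᶜ := by
    have : e.symm ⟨(B : Set Y)ᶜ, B.2.compl⟩ = ⟨(e.symm B : Set Ω)ᶜ, (e.symm B).2.compl⟩ := by
      rw [Equiv.symm_apply_eq]
      ext1
      rw [hcompl (e.symm B)]
      simp
    rw [this]
  have eunion (B : ℕ → {B : Set Y // MeasurableSet B}) :
      (e.symm ⟨⋃ n, (B n : Set Y), MeasurableSet.iUnion fun n => (B n).2⟩ : Set Ω) =
        ⋃ n, (e.symm (B n) : Set Ω) := by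
    have : e.symm ⟨⋃ n, (B n : Set Y), MeasurableSet.iUnion fun n => (B n).2⟩ =
        ⟨⋃ n, (e.symm (B n) : Set Ω), MeasurableSet.iUnion fun n => (e.symm (B n)).2⟩ := by
      rw [Equiv.symm_apply_eq]
      ext1
      rw [hunion fun n => e.symm (B n)]
      simp
    rw [this]
  -- A point outside this set would lie in the image of `univᶜ`, which is contained in the image of
  -- `univ ∪ univᶜ = univ`.
  have euniv : (e.symm ⟨Set.univ, MeasurableSet.univ⟩ : Set Ω) = Set.univ := by
    let B : ℕ → {B : Set Y // MeasurableSet B} := fun n =>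
      if n = 0 then ⟨Set.univ, MeasurableSet.univ⟩ else ⟨Set.univᶜ, MeasurableSet.univ.compl⟩
    have h1 := eunion B
    have h2 : (⟨⋃ n, (B n : Set Y), MeasurableSet.iUnion fun n => (B n).2⟩ :
        {B : Set Y // MeasurableSet B}) = ⟨Set.univ, MeasurableSet.univ⟩ := by
      ext1
      exact Set.eq_univ_of_univ_subset (Set.subset_iUnion_of_subset 0 (by simp [B]))
    rw [h2] at h1
    have h3 := ecompl ⟨Set.univ, MeasurableSet.univ⟩
    refine Set.eq_univ_of_forall fun ω => ?_
    by_contra hω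
    have h4 : ω ∈ (e.symm (B 1) : Set Ω) := by
      simp only [B, one_ne_zero, if_false]
      rw [h3]
      exact hω
    exact hω (h1 ▸ Set.mem_iUnion.2 ⟨1, h4⟩)
  obtain ⟨S, hSm, hSsep⟩ := exists_seq_separating Y (p := MeasurableSet) MeasurableSet.empty
    Set.univ
  classical
  -- The Borel sets `B` with `ω ∈ e.symm B` form an ultrafilter closed under countable
  -- intersections. A separating sequence makes it principal: `s n` is the side of `S n` that misses
  -- `ω`, and the complement of `⋃ n, s n` is a single point.
  have key (ω : Ω) : ∃ y : Y, ∀ B : {B : Set Y // MeasurableSet B},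
      ω ∈ (e.symm B : Set Ω) ↔ y ∈ (B : Set Y) := by
    let s : ℕ → {B : Set Y // MeasurableSet B} := fun n =>
      if ω ∈ (e.symm ⟨S n, hSm n⟩ : Set Ω) then ⟨(S n)ᶜ, (hSm n).compl⟩ else ⟨S n, hSm n⟩
    have hs (n : ℕ) : ω ∉ (e.symm (s n) : Set Ω) := by
      by_cases h : ω ∈ (e.symm ⟨S n, hSm n⟩ : Set Ω)
      · simp only [s, h, if_true]
        rw [ecompl ⟨S n, hSm n⟩]
        simpa using h
      · simpa only [s, h, if_false] using h
    have hne : (⋃ n, (s n : Set Y)) ≠ Set.univ := by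
      intro h
      have h1 := eunion s
      have h2 : (⟨⋃ n, (s n : Set Y), MeasurableSet.iUnion fun n => (s n).2⟩ :
        {B : Set Y // MeasurableSet B}) = ⟨Set.univ, MeasurableSet.univ⟩ := by
        ext1
        exact h
      rw [h2, euniv] at h1
      obtain ⟨n, hn⟩ := Set.mem_iUnion.1 (h1 ▸ Set.mem_univ ω)
      exact hs n hn
    obtain ⟨y, hy⟩ := (Set.ne_univ_iff_exists_notMem _).1 hne
    have hy' (z : Y) (hz : z ∉ ⋃ n, (s n : Set Y)) : z = y := by
      refine hSsep z trivial y trivial fun n => ?_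
      have h1 : y ∉ (s n : Set Y) := fun h => hy (Set.mem_iUnion.2 ⟨n, h⟩)
      have h2 : z ∉ (s n : Set Y) := fun h => hz (Set.mem_iUnion.2 ⟨n, h⟩)
      by_cases h : ω ∈ (e.symm ⟨S n, hSm n⟩ : Set Ω)
      · simp only [s, h, if_true, Set.mem_compl_iff, not_not] at h1 h2
        tauto
      · simp only [s, h, if_false] at h1 h2
        tauto
    have hmem (B : {B : Set Y // MeasurableSet B}) (hB : y ∈ (B : Set Y)) :
        ω ∈ (e.symm B : Set Ω) := by
      by_contra hω
      -- If `y ∈ B`, then `B` and the sets `s n` cover `Y`, so `ω` lies in the image of one of them,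
      -- and the `s n` are excluded.
      let r : ℕ → {B : Set Y // MeasurableSet B} := fun
        | 0 => B
        | n + 1 => s n
      have h1 := eunion r
      have h2 : (⟨⋃ n, (r n : Set Y), MeasurableSet.iUnion fun n => (r n).2⟩ :
          {B : Set Y // MeasurableSet B}) = ⟨Set.univ, MeasurableSet.univ⟩ := by
        ext1
        refine Set.eq_univ_of_forall fun z => ?_
        by_cases hz : z ∈ ⋃ n, (s n : Set Y)
        · obtain ⟨n, hn⟩ := Set.mem_iUnion.1 hz
          exact Set.mem_iUnion.2 ⟨n + 1, hn⟩
        · exact Set.mem_iUnion.2 ⟨0, hy' z hz ▸ hB⟩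
      rw [h2, euniv] at h1
      obtain ⟨n, hn⟩ := Set.mem_iUnion.1 (h1 ▸ Set.mem_univ ω)
      cases n with
      | zero => exact hω hn
      | succ n => exact hs n hn
    refine ⟨y, fun B => ⟨fun hω => ?_, hmem B⟩⟩
    by_contra hB
    have h1 := hmem ⟨(B : Set Y)ᶜ, B.2.compl⟩ hB
    rw [ecompl B] at h1
    exact h1 hω
  choose φ hφ using key
  have hpre (B : {B : Set Y // MeasurableSet B}) : (e.symm B : Set Ω) = φ ⁻¹' B := by
    ext ω
    exact hφ ω B
  refine ⟨Y, inferInstance, inferInstance, φ, fun y => ?_, ?_⟩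
  -- A missed point `y` would give `{y}` and `∅` the same image under `e.symm`.
  · by_contra! h
    have h1 : (e.symm ⟨{y}, measurableSet_singleton y⟩ : Set Ω) =
        e.symm ⟨Set.univᶜ, MeasurableSet.univ.compl⟩ := by
      rw [hpre, hpre]
      ext ω
      simpa using h ω
    have h2 : ({y} : Set Y) = Set.univᶜ :=
      congrArg Subtype.val (e.symm.injective (Subtype.ext h1))
    simp at h2
  · ext A
    constructor
    · intro hA
      refine ⟨e ⟨A, hA⟩, (e ⟨A, hA⟩).2, ?_⟩
      rw [← hpre]
      simp
    · rintro ⟨B, hB, rfl⟩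
      rw [← hpre ⟨B, hB⟩]
      exact (e.symm ⟨B, hB⟩).2

open ProbabilityTheory Preorder in
/-- Consistent laws of a sequence of random variables extend to a law on the path space. -/
theorem exists_measure_map_frestrictLe {X : ℕ → Type*} [∀ n, MeasurableSpace (X n)]
    [∀ n, StandardBorelSpace (X n)] [∀ n, Nonempty (X n)] {φ : ∀ n, Ω → X n}
    (hφ : ∀ n, Measurable (φ n)) (Q : ℕ → Measure Ω) [∀ n, IsProbabilityMeasure (Q n)]
    (hQ : ∀ a, (Q (a + 1)).map (fun ω (i : Finset.Iic a) => φ i ω) =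
      (Q a).map fun ω (i : Finset.Iic a) => φ i ω) :
    ∃ ρ : Measure (∀ n, X n), IsProbabilityMeasure ρ ∧
      ∀ a, ρ.map (frestrictLe a) = (Q a).map fun ω (i : Finset.Iic a) => φ i ω := by
  have hΦ (a : ℕ) : Measurable fun ω (i : Finset.Iic a) => φ i ω :=
    measurable_pi_lambda _ fun i => hφ i
  -- Ionescu-Tulcea with the conditional law of the next coordinate under `Q (n + 1)`. The
  -- consistency `hQ` lets this kernel be composed with the law of the past under `Q n`.
  let κ : (n : ℕ) → Kernel (∀ i : Finset.Iic n, X i) (X (n + 1)) := fun n =>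
    condDistrib (φ (n + 1)) (fun ω (i : Finset.Iic n) => φ i ω) (Q (n + 1))
  have : IsProbabilityMeasure ((Q 0).map (φ 0)) :=
    Measure.isProbabilityMeasure_map (hφ 0).aemeasurable
  refine ⟨Kernel.trajMeasure ((Q 0).map (φ 0)) κ, inferInstance, fun a => ?_⟩
  induction a with
  | zero =>
    rw [Kernel.trajMeasure, Measure.map_comp _ _ (by fun_prop), Kernel.traj_map_frestrictLe,
      Kernel.partialTraj_self, Measure.id_comp]
    refine (Measure.map_map (MeasurableEquiv.measurable _) (hφ 0)).trans ?_
    congr 1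
    ext ω i
    obtain ⟨i, hi⟩ := i
    obtain rfl : i = 0 := by simpa using hi
    rfl
  | succ a ih =>
    let glue : (∀ i : Finset.Iic a, X i) × X (a + 1) → ∀ i : Finset.Iic (a + 1), X i := fun p =>
      IicProdIoc a (a + 1) (p.1, MeasurableEquiv.piSingleton a p.2)
    have hglue : Measurable glue := measurable_IicProdIoc.comp
      (measurable_fst.prodMk ((MeasurableEquiv.piSingleton a).measurable.comp measurable_snd))
    have h1 : frestrictLe (π := X) (a + 1) = glue ∘ fun x => (frestrictLe a x, x (a + 1)) := by
      ext x ⟨i, hi⟩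
      simp only [glue, IicProdIoc, Function.comp]
      split_ifs with h
      · rfl
      · obtain rfl : i = a + 1 := by
          have := Finset.mem_Iic.1 hi
          simp at h
          omega
        rfl
    have h2 : (fun ω (i : Finset.Iic (a + 1)) => φ i ω) =
        glue ∘ fun ω => (fun i : Finset.Iic a => φ i ω, φ (a + 1) ω) := by
      ext ω ⟨i, hi⟩
      exact congrFun (congrFun h1 fun n => φ n ω) ⟨i, hi⟩
    rw [h1, ← Measure.map_map hglue (by fun_prop),
      ← Kernel.map_frestrictLe_trajMeasure_compProd_eq_map_trajMeasure, ih, h2,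
      ← Measure.map_map hglue ((hΦ a).prodMk (hφ (a + 1))), ← hQ a]
    simp only [κ]
    rw [compProd_map_condDistrib (hφ (a + 1)).aemeasurable]

open ProbabilityTheory Preorder in
/-- Consistent probability measures on a standard filtration extend to `𝓕_∞`. -/
theorem IsStandardFiltration.exists_extension {𝓕 : Filtration ℕ mΩ} (h𝓕 : IsStandardFiltration 𝓕)
    (Q : ℕ → Measure Ω) [∀ n, IsProbabilityMeasure (Q n)]
    (hQ : ∀ n A, MeasurableSet[𝓕 n] A → Q (n + 1) A = Q n A) :
    ∃ ρ : Measure[⨆ n, 𝓕 n] Ω, IsProbabilityMeasure ρ ∧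
      ∀ n A, MeasurableSet[𝓕 n] A → ρ A = Q n A := by
  choose Y mY hY φ hsurj hcomap using fun n => (h𝓕.1 n).exists_surjective_eq_comap
  have hΩ : Nonempty Ω := (Q 0).nonempty_of_neZero
  have hne (n : ℕ) : Nonempty (Y n) := hΩ.map (φ n)
  have hφ𝓕 {i n : ℕ} (hin : i ≤ n) : Measurable[𝓕 n] (φ i) := by
    refine Measurable.mono ?_ (𝓕.mono hin) le_rfl
    rw [hcomap i]
    exact comap_measurable _
  have hφ (n : ℕ) : Measurable (φ n) := (hφ𝓕 le_rfl).mono (𝓕.le n) le_rfl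
  have hΦ𝓕 (a : ℕ) : Measurable[𝓕 a] fun ω (i : Finset.Iic a) => φ i ω :=
    @measurable_pi_lambda _ _ _ (𝓕 a) _ _ fun i => hφ𝓕 (Finset.mem_Iic.1 i.2)
  have hΦ (a : ℕ) : Measurable fun ω (i : Finset.Iic a) => φ i ω := (hΦ𝓕 a).mono (𝓕.le a) le_rfl
  obtain ⟨ρ, hρ, hρmap⟩ := exists_measure_map_frestrictLe hφ Q fun a => by
    ext B hB
    rw [Measure.map_apply (hΦ a) hB, Measure.map_apply (hΦ a) hB]
    exact hQ a _ (hΦ𝓕 a hB)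
  -- the connecting maps
  have hconn (n : ℕ) : ∃ f : Y (n + 1) → Y n, Measurable f ∧ φ n = f ∘ φ (n + 1) := by
    refine Measurable.exists_eq_measurable_comp ?_
    rw [← hcomap (n + 1)]
    exact hφ𝓕 n.le_succ
  choose f hf hfφ using hconn
  -- `N` is the inverse limit. It has full measure because the law of the coordinates up to `n + 1`
  -- is an image of a measure on `Ω`, where `φ n = f n ∘ φ (n + 1)` everywhere.
  let N : Set (∀ n, Y n) := ⋂ n, {y | f n (y (n + 1)) = y n}
  have hNm : MeasurableSet N := MeasurableSet.iInter fun n =>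
    measurableSet_eq_fun ((hf n).comp (measurable_pi_apply _)) (measurable_pi_apply _)
  have hN : ∀ᵐ y ∂ρ, y ∈ N := by
    simp only [N, Set.mem_iInter, Set.mem_ofPred_eq]
    refine ae_all_iff.2 fun n => ?_
    have h1 : MeasurableSet {z : ∀ i : Finset.Iic (n + 1), Y i |
        f n (z ⟨n + 1, by simp⟩) = z ⟨n, by simp⟩} :=
      measurableSet_eq_fun ((hf n).comp (measurable_pi_apply _)) (measurable_pi_apply _)
    have h2 : ∀ᵐ z ∂(ρ.map (frestrictLe (n + 1))),
        f n (z ⟨n + 1, by simp⟩) = z ⟨n, by simp⟩ := by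
      rw [hρmap (n + 1)]
      rw [ae_map_iff (hΦ _).aemeasurable h1]
      exact ae_of_all _ fun ω => (congrFun (hfφ n) ω).symm
    exact ae_of_ae_map (by fun_prop) h2
  -- Since `𝓕 n` is pulled back along `φ n`, the nonempty fibres of `φ n` are its atoms;
  -- compatibility makes them decrease, and the assumption on atoms provides a common point. The
  -- extension is then the image of `ρ` under a choice `s` of such points.
  have hlift (y : ∀ n, Y n) (hy : y ∈ N) : ∃ ω, ∀ n, φ n ω = y n := by
    have h1 : (⋂ n, φ n ⁻¹' {y n}).Nonempty := by
      refine h𝓕.2 _ (fun n => ⟨hφ𝓕 le_rfl (measurableSet_singleton _), ?_, ?_⟩) ?_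
      · obtain ⟨ω, hω⟩ := hsurj n (y n)
        exact ⟨ω, hω⟩
      · intro B hB hBy
        rw [hcomap n] at hB
        obtain ⟨C, -, rfl⟩ := hB
        by_cases h : y n ∈ C
        · right
          refine hBy.antisymm fun ω hω => ?_
          rw [Set.mem_preimage, Set.mem_singleton_iff] at hω
          rwa [Set.mem_preimage, hω]
        · left
          refine Set.eq_empty_of_forall_notMem fun ω hω => h ?_
          have := hBy hω
          rw [Set.mem_preimage, Set.mem_singleton_iff] at this
          exact this ▸ hω
      · refine antitone_nat_of_succ_le fun n ω hω => ?_
        simp only [Set.mem_preimage, Set.mem_singleton_iff] at hω ⊢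
        rw [hfφ n, Function.comp, hω]
        exact Set.mem_iInter.1 hy n
    obtain ⟨ω, hω⟩ := h1
    exact ⟨ω, fun n => Set.mem_iInter.1 hω n⟩
  classical
  let s : (∀ n, Y n) → Ω := fun y => if hy : y ∈ N then (hlift y hy).choose else hΩ.some
  have hs (y : ∀ n, Y n) (hy : y ∈ N) (n : ℕ) : φ n (s y) = y n := by
    simp only [s, hy, dif_pos]
    exact (hlift y hy).choose_spec n
  have hpre (n : ℕ) (C : Set (Y n)) :
      s ⁻¹' (φ n ⁻¹' C) = N ∩ (fun y => y n) ⁻¹' C ∪ Nᶜ ∩ {_y | φ n hΩ.some ∈ C} := by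
    ext y
    by_cases hy : y ∈ N
    · simp [hy, hs y hy n]
    · simp [hy, s]
  have hsm : @Measurable _ _ _ (⨆ n, 𝓕 n) s := by
    rw [measurable_iff_comap_le, MeasurableSpace.comap_iSup, iSup_le_iff]
    intro n
    rw [← measurable_iff_comap_le, hcomap n]
    rintro _ ⟨C, hC, rfl⟩
    rw [hpre]
    exact (hNm.inter (measurable_pi_apply n hC)).union (hNm.compl.inter (MeasurableSet.const _))
  refine ⟨@Measure.map _ _ _ (⨆ n, 𝓕 n) s ρ, ?_, ?_⟩
  · constructor
    rw [@Measure.map_apply _ _ _ (⨆ n, 𝓕 n) _ _ hsm _ MeasurableSet.univ, Set.preimage_univ,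
      measure_univ]
  · intro n A hA
    rw [@Measure.map_apply _ _ _ (⨆ n, 𝓕 n) _ _ hsm _ (le_iSup (fun n => 𝓕 n) n _ hA)]
    rw [hcomap n] at hA
    obtain ⟨C, hC, rfl⟩ := hA
    have h1 : ρ (s ⁻¹' (φ n ⁻¹' C)) = ρ ((fun y => y n) ⁻¹' C) := by
      refine measure_congr ?_
      filter_upwards [hN] with y hy
      exact propext (by change φ n (s y) ∈ C ↔ _; rw [hs y hy]; rfl)
    have h2 : MeasurableSet {z : ∀ i : Finset.Iic n, Y i | z ⟨n, by simp⟩ ∈ C} :=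
      measurable_pi_apply _ hC
    have h3 := congrArg (fun ν => ν {z : ∀ i : Finset.Iic n, Y i | z ⟨n, by simp⟩ ∈ C}) (hρmap n)
    simp only at h3
    rw [Measure.map_apply (by fun_prop) h2, Measure.map_apply (hΦ n) h2] at h3
    rw [h1]
    exact h3

/-! ### Multiplicative decomposition of nonnegative supermartingales -/

/-- Two functions with the same integrals on `m`-measurable sets have the same integrals against
`m`-measurable functions. -/
theorem lintegral_mul_eq_of_forall_setLIntegral_eq {Ω : Type*} {m mΩ : MeasurableSpace Ω}
    (hm : m ≤ mΩ) {P : Measure Ω} {U V H : Ω → ℝ≥0∞} (hU : Measurable U) (hV : Measurable V)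
    (hUV : ∀ A, MeasurableSet[m] A → ∫⁻ ω in A, U ω ∂P = ∫⁻ ω in A, V ω ∂P)
    (hH : Measurable[m] H) : ∫⁻ ω, H ω * U ω ∂P = ∫⁻ ω, H ω * V ω ∂P := by
  have h1 : (P.withDensity U).trim hm = (P.withDensity V).trim hm := by
    refine @Measure.ext _ m _ _ fun A hA => ?_
    rw [trim_measurableSet_eq hm hA, trim_measurableSet_eq hm hA, withDensity_apply _ (hm A hA),
      withDensity_apply _ (hm A hA), hUV A hA]
  have h2 (W : Ω → ℝ≥0∞) (hW : Measurable W) :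
      ∫⁻ ω, H ω * W ω ∂P = ∫⁻ ω, H ω ∂(P.withDensity W).trim hm := by
    rw [lintegral_trim hm hH, lintegral_withDensity_eq_lintegral_mul _ hW (hH.mono hm le_rfl)]
    simp only [Pi.mul_apply, mul_comm]
  rw [h2 U hU, h2 V hV, h1]

theorem setLIntegral_mul_eq_of_forall_setLIntegral_eq {Ω : Type*} {m mΩ : MeasurableSpace Ω}
    (hm : m ≤ mΩ) {P : Measure Ω} {U V H : Ω → ℝ≥0∞} (hU : Measurable U) (hV : Measurable V)
    (hUV : ∀ A, MeasurableSet[m] A → ∫⁻ ω in A, U ω ∂P = ∫⁻ ω in A, V ω ∂P)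
    (hH : Measurable[m] H) {A : Set Ω} (hA : MeasurableSet[m] A) :
    ∫⁻ ω in A, H ω * U ω ∂P = ∫⁻ ω in A, H ω * V ω ∂P := by
  have := lintegral_mul_eq_of_forall_setLIntegral_eq hm hU hV hUV (hH.indicator hA)
  simpa only [← Set.indicator_mul_left, lintegral_indicator (hm A hA)] using this

/-- Multiplicative decomposition: if `G n = g n + G (n + 1)` with `g` adapted, then the
supermartingale `E[G n | 𝓕 n]` is the product of a martingale `M` and a decreasing predictable
process `D`. -/
theorem exists_multiplicative_decomposition {P : Measure Ω} [IsProbabilityMeasure P]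
    {𝓕 : Filtration ℕ mΩ} (h𝓕₀ : 𝓕 0 = ⊥) {g G : ℕ → Ω → ℝ≥0∞}
    (hg : ∀ n, Measurable[𝓕 n] (g n))
    (hG : ∀ n ω, G n ω = g n ω + G (n + 1) ω) (hG0 : ∫⁻ ω, G 0 ω ∂P = 1) :
    ∃ M D : ℕ → Ω → ℝ≥0∞,
      (∀ n, Measurable[𝓕 n] (M n)) ∧ (∀ ω, M 0 ω = 1) ∧
      (∀ n A, MeasurableSet[𝓕 n] A → ∫⁻ ω in A, M (n + 1) ω ∂P = ∫⁻ ω in A, M n ω ∂P) ∧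
      (∀ n, Measurable[𝓕 n] (D (n + 1))) ∧ (∀ ω, D 0 ω = 1) ∧ (∀ n ω, D (n + 1) ω ≤ D n ω) ∧
      (∀ n, ∀ᵐ ω ∂P, M n ω * D n ω = g n ω + M n ω * D (n + 1) ω) ∧
      ∀ n A, MeasurableSet[𝓕 n] A → ∫⁻ ω in A, M n ω * D n ω ∂P = ∫⁻ ω in A, G n ω ∂P := by
  classical
  -- `V n` and `U n = g n + V n` are versions of `E[G (n + 1) | 𝓕 n]` and `E[G n | 𝓕 n]`, so `V n`
  -- is the predictable part of the next value of the supermartingale `U`.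
  let V : ℕ → Ω → ℝ≥0∞ := fun n => condLExp (𝓕 n) P (G (n + 1))
  have hV (n : ℕ) : Measurable[𝓕 n] (V n) := measurable_condLExp _ _ _
  let U : ℕ → Ω → ℝ≥0∞ := fun n ω => g n ω + V n ω
  have hU (n : ℕ) : Measurable[𝓕 n] (U n) := (hg n).add (hV n)
  have hVi (n : ℕ) (A : Set Ω) (hA : MeasurableSet[𝓕 n] A) :
      ∫⁻ ω in A, V n ω ∂P = ∫⁻ ω in A, G (n + 1) ω ∂P :=
    setLIntegral_condLExp (𝓕.le n) P _ hA
  have hUi (n : ℕ) (A : Set Ω) (hA : MeasurableSet[𝓕 n] A) :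
      ∫⁻ ω in A, U n ω ∂P = ∫⁻ ω in A, G n ω ∂P := by
    simp only [U, hG n]
    rw [lintegral_add_left ((hg n).mono (𝓕.le n) le_rfl), hVi n A hA,
      lintegral_add_left ((hg n).mono (𝓕.le n) le_rfl)]
  have hUV (n : ℕ) (A : Set Ω) (hA : MeasurableSet[𝓕 n] A) :
      ∫⁻ ω in A, U (n + 1) ω ∂P = ∫⁻ ω in A, V n ω ∂P := by
    rw [hUi (n + 1) A (𝓕.mono n.le_succ A hA), hVi n A hA]
  have hGle (n : ℕ) : ∫⁻ ω, G n ω ∂P ≤ 1 := by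
    induction n with
    | zero => exact hG0.le
    | succ n ih =>
      refine (lintegral_mono fun ω => ?_).trans ih
      rw [hG n]
      exact le_add_self
  have hUfin (n : ℕ) : ∀ᵐ ω ∂P, U n ω < ∞ := by
    refine ae_lt_top ((hU n).mono (𝓕.le n) le_rfl) ?_
    have := hUi n Set.univ MeasurableSet.univ
    simp only [Measure.restrict_univ] at this
    rw [this]
    exact ((hGle n).trans_lt ENNReal.one_lt_top).ne
  have hUzero (n : ℕ) : ∀ᵐ ω ∂P, V n ω = 0 → U (n + 1) ω = 0 := by
    have hA : MeasurableSet[𝓕 n] (V n ⁻¹' {0}) := hV n (measurableSet_singleton 0)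
    have h1 : ∫⁻ ω in V n ⁻¹' {0}, U (n + 1) ω ∂P = 0 := by
      rw [hUV n _ hA, setLIntegral_congr_fun (g := fun _ => 0) (𝓕.le n _ hA) (fun ω hω => hω)]
      simp
    rw [lintegral_eq_zero_iff ((hU (n + 1)).mono (𝓕.le _) le_rfl)] at h1
    exact (ae_restrict_iff' (𝓕.le n _ hA)).1 h1
  -- Multiply by `U (n + 1) / V n`, which has conditional mean one on `{V n ≠ 0}`. On `{V n = 0}`
  -- the value is frozen to keep the martingale property; there `U (n + 1)` vanishes anyway.
  let M : ℕ → Ω → ℝ≥0∞ := fun n => Nat.rec (fun _ => 1)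
    (fun n f ω => (V n ⁻¹' {0}).indicator f ω +
      (V n ⁻¹' {0})ᶜ.indicator (fun ω => f ω / V n ω) ω * U (n + 1) ω) n
  have hMs (n : ℕ) (ω : Ω) : M (n + 1) ω = (V n ⁻¹' {0}).indicator (M n) ω +
      (V n ⁻¹' {0})ᶜ.indicator (fun ω => M n ω / V n ω) ω * U (n + 1) ω := rfl
  -- On `{U n = 0}` also `V n = 0`, and `0 / 0 = 0` in `ℝ≥0∞`, so `D` drops to zero.
  let D : ℕ → Ω → ℝ≥0∞ := fun n => Nat.rec (fun _ => 1) (fun n f ω => f ω * (V n ω / U n ω)) n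
  have hDs (n : ℕ) (ω : Ω) : D (n + 1) ω = D n ω * (V n ω / U n ω) := rfl
  have hVs (n : ℕ) : MeasurableSet[𝓕 n] (V n ⁻¹' {0}) := hV n (measurableSet_singleton 0)
  have hH (n : ℕ) (hMn : Measurable[𝓕 n] (M n)) :
      Measurable[𝓕 n] ((V n ⁻¹' {0})ᶜ.indicator (fun ω => M n ω / V n ω)) :=
    (hMn.div (hV n)).indicator (hVs n).compl
  have hM (n : ℕ) : Measurable[𝓕 n] (M n) := by
    induction n with
    | zero => exact measurable_const
    | succ n ih =>
      have h1 := (ih.indicator (hVs n)).mono (𝓕.mono n.le_succ) le_rfl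
      have h2 := (hH n ih).mono (𝓕.mono n.le_succ) le_rfl
      exact h1.add (h2.mul (hU (n + 1)))
  have hD (n : ℕ) : Measurable[𝓕 n] (D n) ∧ Measurable[𝓕 n] (D (n + 1)) := by
    induction n with
    | zero =>
      have h1 : Measurable[𝓕 0] (D 0) := measurable_const
      exact ⟨h1, h1.mul ((hV 0).div (hU 0))⟩
    | succ n ih =>
      have h1 := ih.2.mono (𝓕.mono n.le_succ) le_rfl
      exact ⟨h1, h1.mul ((hV (n + 1)).div (hU (n + 1)))⟩
  have hMD (n : ℕ) : ∀ᵐ ω ∂P, M n ω * D n ω = U n ω := by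
    induction n with
    | zero =>
      -- Triviality of `𝓕 0` makes `U 0` a constant, hence equal to its integral `1 = M 0 * D 0`.
      obtain ⟨c, hc⟩ := eq_const_of_measurable_bot (f := U 0) (h𝓕₀ ▸ hU 0)
      have h1 := hUi 0 Set.univ MeasurableSet.univ
      simp only [Measure.restrict_univ, hG0, hc, lintegral_const, measure_univ, mul_one] at h1
      refine ae_of_all _ fun ω => ?_
      rw [hc, h1]
      exact mul_one _
    | succ n ih =>
      filter_upwards [ih, hUfin n, hUzero n] with ω h1 h2 h3
      rw [hMs, hDs]
      by_cases hv : V n ω = 0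
      · simp [hv, h3 hv]
      · have hu : U n ω ≠ 0 := fun h => hv (add_eq_zero.1 h).2
        have hv' : V n ω ≠ ∞ := fun h => h2.ne (by simp [U, h])
        have e1 : (V n ⁻¹' {0}).indicator (M n) ω = 0 := Set.indicator_of_notMem (by simpa) _
        have e2 : (V n ⁻¹' {0})ᶜ.indicator (fun ω => M n ω / V n ω) ω = M n ω / V n ω :=
          Set.indicator_of_mem (by simpa) _
        rw [e1, e2, zero_add]
        calc M n ω / V n ω * U (n + 1) ω * (D n ω * (V n ω / U n ω))
            = M n ω * D n ω * (V n ω * (V n ω)⁻¹) * (U n ω)⁻¹ * U (n + 1) ω := by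
              simp only [div_eq_mul_inv]; ring
          _ = U (n + 1) ω := by
              rw [h1, ENNReal.mul_inv_cancel hv hv', mul_one, ENNReal.mul_inv_cancel hu h2.ne,
                one_mul]
  refine ⟨M, D, hM, fun _ => rfl, fun n A hA => ?_, fun n => (hD n).2, fun _ => rfl,
    fun n ω => ?_, fun n => ?_, fun n A hA => ?_⟩
  · have hMm := (hM n).mono (𝓕.le n) le_rfl
    have hVm := (hV n).mono (𝓕.le n) le_rfl
    have hUm := (hU (n + 1)).mono (𝓕.le (n + 1)) le_rfl
    simp only [hMs]
    rw [lintegral_add_left (hMm.indicator (𝓕.le n _ (hVs n))),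
      setLIntegral_mul_eq_of_forall_setLIntegral_eq (𝓕.le n) hUm hVm (hUV n) (hH n (hM n)) hA,
      ← lintegral_add_left (hMm.indicator (𝓕.le n _ (hVs n)))]
    refine lintegral_congr_ae (ae_restrict_of_ae ?_)
    filter_upwards [hUfin n] with ω h2
    have hv' : V n ω ≠ ∞ := fun h => h2.ne (by simp [U, h])
    by_cases hv : V n ω = 0
    · simp [hv]
    · have e1 : (V n ⁻¹' {0}).indicator (M n) ω = 0 := Set.indicator_of_notMem (by simpa) _
      have e2 : (V n ⁻¹' {0})ᶜ.indicator (fun ω => M n ω / V n ω) ω = M n ω / V n ω :=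
        Set.indicator_of_mem (by simpa) _
      rw [e1, e2, zero_add, ENNReal.div_mul_cancel hv hv']
  · rw [hDs]
    refine mul_le_of_le_one_right' ?_
    exact ENNReal.div_le_of_le_mul (by rw [one_mul]; exact le_add_self)
  · filter_upwards [hMD n, hUfin n] with ω h1 h2
    rw [hDs, ← mul_assoc, h1]
    by_cases hu : U n ω = 0
    · have := add_eq_zero.1 hu
      simp [hu, this.1]
    · rw [ENNReal.mul_div_cancel hu h2.ne]
  · rw [← hUi n A hA]
    exact lintegral_congr_ae (ae_restrict_of_ae (hMD n))

/-! ### Density processes of locally absolutely continuous measures -/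

/-- Domination on a generating algebra implies absolute continuity. -/
theorem absolutelyContinuous_of_forall_le_mul {α : Type*} {m : MeasurableSpace α}
    {ν ρ : Measure α} [IsFiniteMeasure ν] [IsFiniteMeasure ρ] {𝒜 : Set (Set α)}
    (h𝒜 : IsSetAlgebra 𝒜) (hgen : m = MeasurableSpace.generateFrom 𝒜) {c : ℝ≥0∞} (hc : c ≠ ∞)
    (hle : ∀ t ∈ 𝒜, ν t ≤ c * ρ t) : ν ≪ ρ := by
  refine Measure.AbsolutelyContinuous.mk fun A hA hρA => ?_
  -- Sets of the algebra approximate `A` simultaneously for `ν` and `ρ`, so the domination on the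
  -- algebra passes to `A` up to an error `(c + 1) ε`.
  have hdense := Measure.MeasureDense.of_generateFrom_isSetAlgebra_finite (ν + ρ) h𝒜 hgen
  have key (ε : ℝ) (hε : 0 < ε) : ν A ≤ (c + 1) * ENNReal.ofReal ε := by
    obtain ⟨t, ht, hlt⟩ := hdense.approx A hA (measure_ne_top _ _) ε hε
    have h1 : ρ t ≤ ENNReal.ofReal ε := by
      calc ρ t ≤ ρ (A ∪ symmDiff A t) := measure_mono fun x hx => by
            by_cases h : x ∈ A
            · exact Or.inl h
            · exact Or.inr (Or.inr ⟨hx, h⟩)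
        _ ≤ ρ A + ρ (symmDiff A t) := measure_union_le _ _
        _ ≤ 0 + (ν + ρ) (symmDiff A t) := by
            rw [hρA]
            gcongr
            exact Measure.le_add_left le_rfl
        _ ≤ ENNReal.ofReal ε := by rw [zero_add]; exact hlt.le
    calc ν A ≤ ν (t ∪ symmDiff A t) := measure_mono fun x hx => by
          by_cases h : x ∈ t
          · exact Or.inl h
          · exact Or.inr (Or.inl ⟨hx, h⟩)
      _ ≤ ν t + ν (symmDiff A t) := measure_union_le _ _
      _ ≤ c * ENNReal.ofReal ε + ENNReal.ofReal ε := by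
          gcongr
          · exact (hle t ht).trans (by gcongr)
          · exact (Measure.le_iff'.1 (Measure.le_add_right le_rfl) _).trans hlt.le
      _ = (c + 1) * ENNReal.ofReal ε := by ring
  have hlim : Tendsto (fun ε : ℝ => (c + 1) * ENNReal.ofReal ε) (𝓝[>] 0) (𝓝 0) := by
    have h1 : Tendsto (fun ε : ℝ => ENNReal.ofReal ε) (𝓝[>] 0) (𝓝 0) := by
      have := ENNReal.continuous_ofReal.tendsto (0 : ℝ)
      rw [ENNReal.ofReal_zero] at this
      exact this.mono_left nhdsWithin_le_nhds
    have h2 := ENNReal.Tendsto.const_mul h1 (Or.inr (by finiteness : c + 1 ≠ ∞))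
    rwa [mul_zero] at h2
  exact le_antisymm (ge_of_tendsto hlim (eventually_nhdsWithin_of_forall key)) zero_le

theorem isSetAlgebra_iUnion_filtration (𝓕 : Filtration ℕ mΩ) :
    IsSetAlgebra {A | ∃ n, MeasurableSet[𝓕 n] A} where
  empty_mem := ⟨0, @MeasurableSet.empty _ (𝓕 0)⟩
  compl_mem := fun _ ⟨n, hs⟩ => ⟨n, hs.compl⟩
  union_mem := fun _ _ ⟨n, hs⟩ ⟨k, ht⟩ =>
    ⟨max n k, (𝓕.mono (le_max_left n k) _ hs).union (𝓕.mono (le_max_right n k) _ ht)⟩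

theorem iSup_filtration_eq_generateFrom (𝓕 : Filtration ℕ mΩ) :
    ⨆ n, 𝓕 n = MeasurableSpace.generateFrom {A | ∃ n, MeasurableSet[𝓕 n] A} :=
  MeasurableSpace.measurableSpace_iSup_eq _

section Density

variable {P : Measure Ω} {𝓕 : Filtration ℕ mΩ} {Q : Measure[⨆ n, 𝓕 n] Ω}

theorem measurable_densityProcess (n : ℕ) : Measurable[𝓕 n] (densityProcess P 𝓕 Q n) :=
  Measure.measurable_rnDeriv _ _

theorem measurable_limitDensity : Measurable[⨆ n, 𝓕 n] (limitDensity P 𝓕 Q) :=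
  Measurable.limsup fun n =>
    (measurable_densityProcess n).mono (le_iSup (fun n => 𝓕 n) n) le_rfl

theorem setLIntegral_densityProcess [IsProbabilityMeasure P] [IsProbabilityMeasure Q]
    (hQ : ∀ n A, MeasurableSet[𝓕 n] A → P A = 0 → Q A = 0) {n : ℕ} {A : Set Ω}
    (hA : MeasurableSet[𝓕 n] A) : ∫⁻ ω in A, densityProcess P 𝓕 Q n ω ∂P = Q A := by
  have hac : Q.trim (le_iSup (fun n => 𝓕 n) n) ≪ P.trim (𝓕.le n) := by
    refine Measure.AbsolutelyContinuous.mk fun B hB hPB => ?_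
    rw [trim_measurableSet_eq _ hB] at hPB ⊢
    exact hQ n B hB hPB
  rw [← setLIntegral_trim (𝓕.le n) (measurable_densityProcess n) hA, densityProcess,
    Measure.setLIntegral_rnDeriv' hac hA, trim_measurableSet_eq _ hA]

theorem densityProcess_lt_top [IsProbabilityMeasure P] [IsProbabilityMeasure Q]
    (hQ : ∀ n A, MeasurableSet[𝓕 n] A → P A = 0 → Q A = 0) (n : ℕ) :
    ∀ᵐ ω ∂P, densityProcess P 𝓕 Q n ω < ∞ := by
  refine ae_lt_top ((measurable_densityProcess n).mono (𝓕.le n) le_rfl) ?_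
  have := setLIntegral_densityProcess hQ (n := n) MeasurableSet.univ
  rw [Measure.restrict_univ] at this
  rw [this]
  finiteness

/-- On `{M ∞ < ∞}`, the measure `Q` is absolutely continuous with respect to `P`. -/
theorem ae_notMem_of_limitDensity_ne_top [IsProbabilityMeasure P] [IsProbabilityMeasure Q]
    (hQ : ∀ n A, MeasurableSet[𝓕 n] A → P A = 0 → Q A = 0) {A : Set Ω}
    (hA : MeasurableSet[⨆ n, 𝓕 n] A) (hPA : P A = 0) :
    ∀ᵐ ω ∂Q, limitDensity P 𝓕 Q ω ≠ ∞ → ω ∉ A := by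
  have hle : (⨆ n, 𝓕 n) ≤ mΩ := iSup_le fun n => 𝓕.le n
  -- On `{sup_n M_n ≤ k}` the measure `Q` is dominated by `k P` on the generating algebra. These
  -- sets exhaust `{M_∞ < ∞}` up to a `Q`-null set, since each `M_n` is finite `Q`-a.s.
  let E : ℕ → Set Ω := fun k => {ω | ∀ n, densityProcess P 𝓕 Q n ω ≤ k}
  have hEs (k n : ℕ) : MeasurableSet[𝓕 n] {ω | densityProcess P 𝓕 Q n ω ≤ k} :=
    measurable_densityProcess n measurableSet_Iic
  have hE (k : ℕ) : MeasurableSet[⨆ n, 𝓕 n] (E k) := by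
    have : E k = ⋂ n, {ω | densityProcess P 𝓕 Q n ω ≤ k} := by ext; simp [E]
    rw [this]
    exact MeasurableSet.iInter fun n => le_iSup (fun n => 𝓕 n) n _ (hEs k n)
  have hnull (k : ℕ) : Q (A ∩ E k) = 0 := by
    have hac : Q.restrict (E k) ≪ P.trim hle := by
      refine absolutelyContinuous_of_forall_le_mul (isSetAlgebra_iUnion_filtration 𝓕)
        (iSup_filtration_eq_generateFrom 𝓕) (ENNReal.natCast_ne_top k) ?_
      rintro B ⟨n, hB⟩
      have hB' : MeasurableSet[⨆ n, 𝓕 n] B := le_iSup (fun n => 𝓕 n) n _ hB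
      rw [Measure.restrict_apply hB', trim_measurableSet_eq hle hB']
      calc Q (B ∩ E k) ≤ Q (B ∩ {ω | densityProcess P 𝓕 Q n ω ≤ k}) :=
            measure_mono (Set.inter_subset_inter_right _ fun ω hω => hω n)
        _ = ∫⁻ ω in B ∩ {ω | densityProcess P 𝓕 Q n ω ≤ k}, densityProcess P 𝓕 Q n ω ∂P :=
            (setLIntegral_densityProcess hQ (hB.inter (hEs k n))).symm
        _ ≤ ∫⁻ _ in B ∩ {ω | densityProcess P 𝓕 Q n ω ≤ k}, k ∂P :=
            setLIntegral_mono' (𝓕.le n _ (hB.inter (hEs k n))) fun ω hω => hω.2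
        _ = k * P (B ∩ {ω | densityProcess P 𝓕 Q n ω ≤ k}) := setLIntegral_const _ _
        _ ≤ k * P B := by gcongr; exact Set.inter_subset_left
    have := hac (by rw [trim_measurableSet_eq hle hA]; exact hPA : P.trim hle A = 0)
    rwa [Measure.restrict_apply hA] at this
  have hfin : ∀ᵐ ω ∂Q, ∀ n, densityProcess P 𝓕 Q n ω < ∞ := by
    refine ae_all_iff.2 fun n => ?_
    have hm : MeasurableSet[𝓕 n] {ω | ¬ densityProcess P 𝓕 Q n ω < ∞} :=
      (measurable_densityProcess n measurableSet_Iio).compl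
    exact hQ n _ hm (densityProcess_lt_top hQ n)
  have hall : ∀ᵐ ω ∂Q, ∀ k, ω ∉ A ∩ E k :=
    ae_all_iff.2 fun k => measure_eq_zero_iff_ae_notMem.1 (hnull k)
  filter_upwards [hfin, hall] with ω h1 h2 h3 h4
  obtain ⟨k, hk⟩ : ∃ k : ℕ, limitDensity P 𝓕 Q ω < k := ENNReal.exists_nat_gt h3
  obtain ⟨N, hN⟩ := eventually_atTop.1 (eventually_lt_of_limsup_lt hk)
  obtain ⟨l, hl⟩ : ∃ l : ℕ, ∑ n ∈ Finset.range N, densityProcess P 𝓕 Q n ω < l :=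
    ENNReal.exists_nat_gt (ENNReal.sum_lt_top.2 fun n _ => h1 n).ne
  refine h2 (max k l) ⟨h4, fun n => ?_⟩
  by_cases hn : N ≤ n
  · exact (hN n hn).le.trans (Nat.mono_cast (le_max_left k l))
  · exact ((Finset.single_le_sum (f := fun n => densityProcess P 𝓕 Q n ω)
      (fun _ _ => zero_le) (Finset.mem_range.2 (not_le.1 hn))).trans hl.le).trans
      (Nat.mono_cast (le_max_right k l))

/-- `M ∞` is finite `P`-almost surely. -/
theorem limitDensity_lt_top [IsProbabilityMeasure P] [IsProbabilityMeasure Q]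
    (hQ : ∀ n A, MeasurableSet[𝓕 n] A → P A = 0 → Q A = 0) :
    ∀ᵐ ω ∂P, limitDensity P 𝓕 Q ω < ∞ := by
  have hm (n : ℕ) : Measurable (densityProcess P 𝓕 Q n) :=
    (measurable_densityProcess n).mono (𝓕.le n) le_rfl
  have hone (n : ℕ) : ∫⁻ ω, densityProcess P 𝓕 Q n ω ∂P = 1 := by
    have := setLIntegral_densityProcess hQ (n := n) MeasurableSet.univ
    rwa [Measure.restrict_univ, measure_univ] at this
  have hint (n : ℕ) : Integrable (fun ω => (densityProcess P 𝓕 Q n ω).toReal) P :=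
    integrable_toReal_of_lintegral_ne_top (hm n).aemeasurable (by simp [hone])
  -- A martingale bounded in `L¹` converges a.s. to a finite limit.
  have hmart : Martingale (fun n ω => (densityProcess P 𝓕 Q n ω).toReal) 𝓕 P := by
    refine martingale_of_setIntegral_eq_succ
      (fun n => (measurable_densityProcess n).ennreal_toReal.stronglyMeasurable) hint ?_
    intro n A hA
    rw [integral_toReal (hm n).aemeasurable (ae_restrict_of_ae (densityProcess_lt_top hQ n)),
      integral_toReal (hm _).aemeasurable (ae_restrict_of_ae (densityProcess_lt_top hQ _)),
      setLIntegral_densityProcess hQ hA,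
      setLIntegral_densityProcess hQ (𝓕.mono n.le_succ _ hA)]
  have hbdd (n : ℕ) :
      eLpNorm (fun ω => (densityProcess P 𝓕 Q n ω).toReal) 1 P ≤ (1 : NNReal) := by
    rw [eLpNorm_one_eq_lintegral_enorm, ENNReal.coe_one, ← hone n]
    refine lintegral_mono fun ω => ?_
    rw [← ofReal_norm, Real.norm_of_nonneg ENNReal.toReal_nonneg]
    exact ENNReal.ofReal_toReal_le
  filter_upwards [hmart.submartingale.exists_ae_tendsto_of_bdd hbdd,
    ae_all_iff.2 (densityProcess_lt_top hQ)] with ω ⟨c, hc⟩ hfin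
  have h1 : Tendsto (fun n => densityProcess P 𝓕 Q n ω) atTop (𝓝 (ENNReal.ofReal c)) := by
    refine ((ENNReal.continuous_ofReal.tendsto c).comp hc).congr fun n => ?_
    exact ENNReal.ofReal_toReal (hfin n).ne
  rw [limitDensity, h1.limsup_eq]
  exact ENNReal.ofReal_lt_top

end Density

/-! ### Sums over the time set -/

theorem range_natCast_enat : Set.range ((↑) : ℕ → ℕ∞) = {t | t ≠ ⊤} := by
  ext t
  exact ENat.ne_top_iff_exists.symm

theorem hasSum_times_finite (T : ℕ) (f : ℕ∞ → ℝ) :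
    HasSum (fun t : (Horizon.finite T).times => f t) (∑ n ∈ Finset.range (T + 1), f n) := by
  have key (S : Set ℕ∞) (s : Finset ℕ∞) (hS : S = s) :
      HasSum (fun t : S => f t) (∑ t ∈ s, f t) := by
    subst hS
    exact s.hasSum f
  have := key (Horizon.finite T).times ((Finset.range (T + 1)).map Nat.castEmbedding) (by
    ext t
    induction t using ENat.recTopCoe with
    | top => simp [Horizon.times]
    | coe n => simp [Horizon.times])
  rwa [Finset.sum_map] at this

theorem hasSum_times_nat {f : ℕ∞ → ℝ} {s : ℝ} :
    HasSum (fun t : Horizon.nat.times => f t) s ↔ HasSum (fun n : ℕ => f n) s := by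
  have key (S : Set ℕ∞) (hS : S = Set.range ((↑) : ℕ → ℕ∞)) :
      HasSum (fun t : S => f t) s ↔ HasSum (fun n : ℕ => f n) s := by
    subst hS
    exact Nat.cast_injective.hasSum_range_iff
  exact key _ range_natCast_enat.symm

theorem hasSum_times_natInf {f : ℕ∞ → ℝ} {s : ℝ} :
    HasSum (fun t : Horizon.natInf.times => f t) s ↔ HasSum (fun n : ℕ => f n) (s - f ⊤) := by
  have h1 : HasSum (fun t : Horizon.natInf.times => f t) s ↔ HasSum f s :=
    (Equiv.Set.univ ℕ∞).hasSum_iff (f := f)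
  have h2 := Finset.hasSum_compl_iff (f := f) (a := s - f ⊤) {⊤}
  rw [Finset.sum_singleton, sub_add_cancel] at h2
  rw [h1, ← h2, ← hasSum_times_nat]
  have key (S S' : Set ℕ∞) (hS : S = S') :
      HasSum (fun t : S => f t) (s - f ⊤) ↔ HasSum (fun t : S' => f t) (s - f ⊤) := by
    rw [hS]
  exact key {t | t ∉ ({⊤} : Finset ℕ∞)} _ (by ext t; simp [Horizon.times])

/-! ### Measurability with respect to the optional σ-field -/

theorem sigmaAt_le_sigma {h : Horizon} (𝓕 : Filtration ℕ mΩ) {t : ℕ∞} (ht : t ∈ h.times) :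
    sigmaAt 𝓕 t ≤ h.sigma 𝓕 := by
  cases h with
  | finite T =>
    induction t using ENat.recTopCoe with
    | top => simp [Horizon.times] at ht
    | coe n => exact 𝓕.mono (by simpa [Horizon.times] using ht)
  | nat =>
    induction t using ENat.recTopCoe with
    | top => exact le_rfl
    | coe n => exact le_iSup (fun n => 𝓕 n) n
  | natInf =>
    induction t using ENat.recTopCoe with
    | top => exact le_rfl
    | coe n => exact le_iSup (fun n => 𝓕 n) n

theorem measurable_section_sigmaAt (h : Horizon) (𝓕 : Filtration ℕ mΩ) (t : h.times) :
    @Measurable Ω (Ω × h.times) (sigmaAt 𝓕 t) (optionalSigma h 𝓕) (fun ω => (ω, t)) := by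
  refine @measurable_generateFrom Ω (Ω × h.times) (sigmaAt 𝓕 t) _ _ ?_
  rintro B ⟨s, A, hA, rfl⟩
  by_cases hst : t = s
  · subst hst
    have : (fun ω : Ω => (ω, t)) ⁻¹' (A ×ˢ {t}) = A := by ext; simp
    rwa [this]
  · have : (fun ω : Ω => (ω, t)) ⁻¹' (A ×ˢ {s}) = ∅ := by ext; simp [hst]
    rw [this]
    exact @MeasurableSet.empty _ (sigmaAt 𝓕 t)

/-- Since `𝕋` is countable, a preimage is a countable union of generators, one for each time. -/
theorem measurable_optionalSigma {h : Horizon} {𝓕 : Filtration ℕ mΩ} {β : Type*}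
    [MeasurableSpace β] {f : Ω × h.times → β}
    (hf : ∀ t : h.times, Measurable[sigmaAt 𝓕 t] fun ω => f (ω, t)) :
    Measurable[optionalSigma h 𝓕] f := by
  intro S hS
  have : f ⁻¹' S = ⋃ t : h.times, ((fun ω => f (ω, t)) ⁻¹' S) ×ˢ {t} := by
    ext ⟨ω, t⟩
    simp only [Set.mem_preimage, Set.mem_iUnion, Set.mem_prod, Set.mem_singleton_iff]
    exact ⟨fun h => ⟨t, h, rfl⟩, by rintro ⟨_, h, rfl⟩; exact h⟩
  rw [this]
  exact @MeasurableSet.iUnion _ _ (optionalSigma h 𝓕) _ _ fun t =>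
    MeasurableSpace.measurableSet_generateFrom ⟨t, _, hf t hS, rfl⟩

/-! ### Sums of weighted push-forwards -/

section WeightedSum

variable {α β ι : Type*} [MeasurableSpace α] [MeasurableSpace β]

/-- The measure `B ↦ E_Q[∑ i, 1_B(s i) w i]`. -/
def weightedSum (Q : Measure α) (s : ι → α → β) (w : ι → α → ℝ) : Measure β :=
  Measure.sum fun i => (Q.withDensity fun a => ENNReal.ofReal (w i a)).map (s i)

variable {Q : Measure α} {s : ι → α → β} {w : ι → α → ℝ}

theorem lintegral_weightedSum (hs : ∀ i, Measurable (s i)) (hw : ∀ i, Measurable (w i))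
    {f : β → ℝ≥0∞} (hf : Measurable f) :
    ∫⁻ b, f b ∂weightedSum Q s w = ∑' i, ∫⁻ a, ENNReal.ofReal (w i a) * f (s i a) ∂Q := by
  rw [weightedSum, lintegral_sum_measure]
  congr with i
  rw [lintegral_map hf (hs i), lintegral_withDensity_eq_lintegral_mul _ (hw i).ennreal_ofReal
    (g := fun a => f (s i a)) (hf.comp (hs i))]
  rfl

theorem weightedSum_apply_eq_zero (hs : ∀ i, Measurable (s i)) (hw : ∀ i, Measurable (w i))
    {B : Set β} (hB : MeasurableSet B) :
    weightedSum Q s w B = 0 ↔ ∀ i, ∀ᵐ a ∂Q, s i a ∈ B → w i a ≤ 0 := by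
  rw [weightedSum, Measure.sum_apply _ hB, ENNReal.tsum_eq_zero]
  refine forall_congr' fun i => ?_
  rw [Measure.map_apply (hs i) hB, withDensity_apply_eq_zero (hw i).ennreal_ofReal,
    measure_eq_zero_iff_ae_notMem]
  refine eventually_congr (ae_of_all _ fun a => ?_)
  simp
  grind

theorem isProbabilityMeasure_weightedSum [Countable ι] [IsProbabilityMeasure Q] (hs : ∀ i, Measurable (s i))
    (hw : ∀ i, Measurable (w i)) (hnonneg : ∀ᵐ a ∂Q, ∀ i, 0 ≤ w i a)
    (hsum : ∀ᵐ a ∂Q, HasSum (fun i => w i a) 1) :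
    IsProbabilityMeasure (weightedSum Q s w) := by
  constructor
  rw [← lintegral_one, lintegral_weightedSum hs hw measurable_const]
  simp only [mul_one]
  rw [← lintegral_tsum fun i => (hw i).ennreal_ofReal.aemeasurable]
  calc ∫⁻ a, ∑' i, ENNReal.ofReal (w i a) ∂Q = ∫⁻ _, 1 ∂Q := by
        refine lintegral_congr_ae ?_
        filter_upwards [hnonneg, hsum] with a h1 h2
        rw [← ENNReal.ofReal_tsum_of_nonneg h1 h2.summable, h2.tsum_eq, ENNReal.ofReal_one]
    _ = 1 := by simp

/-- Fubini for weighted sums and bounded functions. -/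
theorem integral_weightedSum [Countable ι] [IsProbabilityMeasure Q] (hs : ∀ i, Measurable (s i))
    (hw : ∀ i, Measurable (w i)) (hnonneg : ∀ᵐ a ∂Q, ∀ i, 0 ≤ w i a)
    (hsum : ∀ᵐ a ∂Q, HasSum (fun i => w i a) 1) {f : β → ℝ} (hf : Measurable f) {c : ℝ}
    (hc : ∀ᵐ a ∂Q, ∀ i, w i a = 0 ∨ |f (s i a)| ≤ c) :
    Integrable f (weightedSum Q s w) ∧
    (∀ᵐ a ∂Q, Summable fun i => w i a * f (s i a)) ∧
    Integrable (fun a => ∑' i, w i a * f (s i a)) Q ∧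
    ∫ b, f b ∂weightedSum Q s w = ∫ a, ∑' i, w i a * f (s i a) ∂Q := by
  have hmeas (i : ι) : Measurable fun a => w i a * f (s i a) := (hw i).mul (hf.comp (hs i))
  -- No bound on `f` is needed where the weight vanishes. This matters at `t = ∞`, where a `P`-a.s.
  -- bound on `X_∞` may fail on the part of `Q` singular to `P`.
  have hle : ∀ᵐ a ∂Q, ∀ i, |w i a * f (s i a)| ≤ |c| * w i a := by
    filter_upwards [hnonneg, hc] with a h1 h2 i
    rcases h2 i with h | h
    · simp [h]
    · rw [abs_mul, abs_of_nonneg (h1 i), mul_comm]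
      exact mul_le_mul_of_nonneg_right (h.trans (le_abs_self c)) (h1 i)
  have hsumm : ∀ᵐ a ∂Q, Summable fun i => |w i a * f (s i a)| := by
    filter_upwards [hle, hsum] with a h1 h2
    exact Summable.of_nonneg_of_le (fun i => abs_nonneg _) h1 (h2.summable.mul_left _)
  have hfin : ∑' i, ∫⁻ a, ‖w i a * f (s i a)‖ₑ ∂Q ≠ ∞ := by
    rw [← lintegral_tsum fun i => (hmeas i).enorm.aemeasurable]
    have : ∫⁻ a, ∑' i, ‖w i a * f (s i a)‖ₑ ∂Q ≤ ∫⁻ _, ENNReal.ofReal |c| ∂Q := by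
      refine lintegral_mono_ae ?_
      filter_upwards [hle, hsum, hsumm] with a h1 h2 h3
      simp only [← ofReal_norm, Real.norm_eq_abs]
      rw [← ENNReal.ofReal_tsum_of_nonneg (fun i => abs_nonneg _) h3]
      refine ENNReal.ofReal_le_ofReal ?_
      refine (h3.tsum_le_tsum h1 (h2.summable.mul_left _)).trans_eq ?_
      rw [tsum_mul_left, h2.tsum_eq, mul_one]
    refine (this.trans_lt ?_).ne
    simp
  have hint : Integrable f (weightedSum Q s w) := by
    refine ⟨hf.aestronglyMeasurable, ?_⟩
    rw [HasFiniteIntegral, lintegral_weightedSum hs hw hf.enorm]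
    refine Eq.trans_lt ?_ (lt_top_iff_ne_top.2 hfin)
    congr with i
    refine lintegral_congr_ae ?_
    filter_upwards [hnonneg] with a h1
    rw [enorm_mul, ← ofReal_norm (w i a), Real.norm_of_nonneg (h1 i)]
  have hsummable : ∀ᵐ a ∂Q, Summable fun i => w i a * f (s i a) := by
    filter_upwards [hsumm] with a h using h.of_abs
  refine ⟨hint, hsummable, ?_, ?_⟩
  · refine Integrable.of_bound (C := |c|) ?_ ?_
    · refine aestronglyMeasurable_of_tendsto_ae (atTop : Filter (Finset ι))
        (f := fun F a => ∑ i ∈ F, w i a * f (s i a)) (fun F => ?_) ?_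
      · exact (Finset.measurable_sum F fun i _ => hmeas i).aestronglyMeasurable
      · filter_upwards [hsummable] with a h using h.hasSum
    · filter_upwards [hle, hsum] with a h1 h2
      have h3 := h2.mul_left |c|
      rw [mul_one] at h3
      exact tsum_of_norm_bounded h3 h1
  · rw [integral_tsum (fun i => (hmeas i).aestronglyMeasurable) hfin]
    rw [weightedSum] at hint ⊢
    rw [integral_sum_measure hint]
    congr with i
    rw [integral_map (hs i).aemeasurable hf.aestronglyMeasurable,
      integral_withDensity_eq_integral_toReal_smul (hw i).ennreal_ofReal (by simp)]
    refine integral_congr_ae ?_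
    filter_upwards [hnonneg] with a h1
    rw [ENNReal.toReal_ofReal (h1 i), smul_eq_mul]

end WeightedSum

/-! ### The measure `Q ⊗ γ` -/

/-- The measure `Q ⊗ γ` on the optional σ-field. -/
def tensorMeasure (h : Horizon) (𝓕 : Filtration ℕ mΩ) (Q : Measure[h.sigma 𝓕] Ω)
    (γ : ℕ∞ → Ω → ℝ) : Measure[optionalSigma h 𝓕] (Ω × h.times) :=
  @weightedSum Ω (Ω × h.times) h.times (h.sigma 𝓕) (optionalSigma h 𝓕) Q (fun t ω => (ω, t))
    fun t => γ t

theorem refMeasure_eq_weightedSum (h : Horizon) (P : Measure Ω) (𝓕 : Filtration ℕ mΩ)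
    (μ : ℕ∞ → Ω → ℝ) : refMeasure h P 𝓕 μ =
      @weightedSum Ω (Ω × h.times) h.times mΩ (optionalSigma h 𝓕) P (fun t ω => (ω, t))
        fun t => μ t :=
  rfl

/-- Optional random measures, with nonnegativity only `Q`-almost surely. -/
structure IsWeakRandomMeasure (h : Horizon) (P : Measure Ω) (𝓕 : Filtration ℕ mΩ)
    (Q : Measure[h.sigma 𝓕] Ω) (γ : ℕ∞ → Ω → ℝ) : Prop where
  adapted : IsAdapted h 𝓕 γ
  nonneg : ∀ᵐ ω ∂Q, ∀ t ∈ h.times, 0 ≤ γ t ω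
  hasSum : ∀ᵐ ω ∂Q, HasSum (fun t : h.times => γ t ω) 1
  singular : VanishesOnSingular h P 𝓕 Q (γ ⊤)

section

variable {h : Horizon} {P : Measure Ω} {𝓕 : Filtration ℕ mΩ} {Q : Measure[h.sigma 𝓕] Ω}
  {γ D X : ℕ∞ → Ω → ℝ}

theorem measurable_section_sigma (h : Horizon) (𝓕 : Filtration ℕ mΩ) (t : h.times) :
    @Measurable Ω (Ω × h.times) (h.sigma 𝓕) (optionalSigma h 𝓕) (fun ω => (ω, t)) :=
  (measurable_section_sigmaAt h 𝓕 t).mono (sigmaAt_le_sigma 𝓕 t.2) le_rfl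

theorem IsAdapted.measurable_sigma (hX : IsAdapted h 𝓕 X) (t : h.times) :
    Measurable[h.sigma 𝓕] (X t) :=
  (hX t t.2).mono (sigmaAt_le_sigma 𝓕 t.2) le_rfl

theorem IsAdapted.measurable_optional (hX : IsAdapted h 𝓕 X) :
    Measurable[optionalSigma h 𝓕] fun p : Ω × h.times => X p.2 p.1 :=
  measurable_optionalSigma fun t => hX t t.2

theorem forall_mem_times_iff {p : ℕ∞ → Prop} : (∀ t ∈ h.times, p t) ↔ ∀ t : h.times, p t :=
  ⟨fun H t => H t t.2, fun H t ht => H ⟨t, ht⟩⟩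

theorem IsLocallyAC.ae_of_ae (hQ : IsLocallyAC h P 𝓕 Q) {n : ℕ} (hn : (n : ℕ∞) ∈ h.times)
    {p : Ω → Prop} (hp : MeasurableSet[𝓕 n] {ω | p ω}) (hP : ∀ᵐ ω ∂P, p ω) : ∀ᵐ ω ∂Q, p ω :=
  hQ n hn _ hp.compl hP

/-- `P`-almost sure properties hold `Q ⊗ γ`-almost surely. -/
theorem IsLocallyAC.ae_eq_zero_or [IsProbabilityMeasure P] [IsProbabilityMeasure Q]
    (hQ : IsLocallyAC h P 𝓕 Q) (hγ : VanishesOnSingular h P 𝓕 Q (γ ⊤)) {t : ℕ∞}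
    (ht : t ∈ h.times) {p : Ω → Prop} (hp : MeasurableSet[sigmaAt 𝓕 t] {ω | p ω})
    (hP : ∀ᵐ ω ∂P, p ω) : ∀ᵐ ω ∂Q, γ t ω = 0 ∨ p ω := by
  induction t using ENat.recTopCoe with
  | coe n => filter_upwards [hQ.ae_of_ae ht hp hP] with ω hω using Or.inr hω
  | top =>
    cases h with
    | finite T => simp [Horizon.times] at ht
    | nat => simp [Horizon.times] at ht
    | natInf =>
      -- At `∞`, a `P`-null set is `Q`-null only inside `{M_∞ < ∞}`; the complement is where `γ_∞`
      -- vanishes.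
      have h1 := ae_notMem_of_limitDensity_ne_top (Q := Q)
        (fun n A hA => hQ n (Set.mem_univ _) A hA) (A := {ω | p ω}ᶜ)
        (@MeasurableSet.compl _ _ (⨆ n, 𝓕 n) hp) hP
      filter_upwards [h1, hγ] with ω h2 h3
      by_cases h4 : limitDensity P 𝓕 Q ω = ∞
      · exact Or.inl (h3 h4)
      · exact Or.inr (not_not.1 (h2 h4))

theorem IsOptionalRandomMeasure.isWeakRandomMeasure [IsProbabilityMeasure P]
    [IsProbabilityMeasure Q] (hQ : IsLocallyAC h P 𝓕 Q)
    (hγ : IsOptionalRandomMeasure h P 𝓕 Q γ) : IsWeakRandomMeasure h P 𝓕 Q γ where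
  adapted := hγ.adapted
  nonneg := by
    simp_rw [forall_mem_times_iff]
    refine ae_all_iff.2 fun t => ?_
    have h1 : MeasurableSet[sigmaAt 𝓕 t] {ω | 0 ≤ γ t ω} := hγ.adapted t t.2 measurableSet_Ici
    have h2 := hQ.ae_eq_zero_or hγ.singular t.2 h1 (by
      filter_upwards [hγ.nonneg] with ω h using h t t.2)
    filter_upwards [h2] with ω h3
    rcases h3 with h3 | h3
    · exact h3.ge
    · exact h3
  hasSum := hγ.hasSum
  singular := hγ.singular

theorem IsWeakRandomMeasure.isProbabilityMeasure [IsProbabilityMeasure Q]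
    (hγ : IsWeakRandomMeasure h P 𝓕 Q γ) : IsProbabilityMeasure (tensorMeasure h 𝓕 Q γ) :=
  @isProbabilityMeasure_weightedSum _ _ _ (h.sigma 𝓕) (optionalSigma h 𝓕) _ _ _ _ _
    (measurable_section_sigma h 𝓕) hγ.adapted.measurable_sigma
    (by simpa only [forall_mem_times_iff] using hγ.nonneg) hγ.hasSum

/-- Strict positivity of `μ` means that every section of a `P̄`-null set is `P`-null, and
`IsLocallyAC.ae_eq_zero_or` applies to each section. -/
theorem IsWeakRandomMeasure.absolutelyContinuous [IsProbabilityMeasure P]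
    [IsProbabilityMeasure Q] {μ : ℕ∞ → Ω → ℝ} (hμ : IsReferenceProcess h P 𝓕 μ)
    (hQ : IsLocallyAC h P 𝓕 Q) (hγ : IsWeakRandomMeasure h P 𝓕 Q γ) :
    tensorMeasure h 𝓕 Q γ ≪ refMeasure h P 𝓕 μ := by
  refine Measure.AbsolutelyContinuous.mk fun B hB hPB => ?_
  rw [refMeasure_eq_weightedSum, @weightedSum_apply_eq_zero _ _ _ mΩ (optionalSigma h 𝓕) _ _ _
    (measurable_section h 𝓕) (fun t => (hμ.1 t t.2).mono (sigmaAt_le 𝓕 t) le_rfl) _ hB] at hPB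
  rw [tensorMeasure, @weightedSum_apply_eq_zero _ _ _ (h.sigma 𝓕) (optionalSigma h 𝓕) _ _ _
    (measurable_section_sigma h 𝓕) hγ.adapted.measurable_sigma _ hB]
  intro t
  have h1 : ∀ᵐ ω ∂P, (ω, t) ∉ B := by
    filter_upwards [hPB t, hμ.2.1] with ω h1 h2 h3
    exact absurd (h1 h3) (not_le.2 (h2 t t.2))
  have h2 : MeasurableSet[sigmaAt 𝓕 t] {ω | (ω, t) ∉ B} :=
    measurable_section_sigmaAt h 𝓕 t (@MeasurableSet.compl _ _ (optionalSigma h 𝓕) hB)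
  filter_upwards [hQ.ae_eq_zero_or hγ.singular t.2 h2 h1] with ω h3 h4
  exact (h3.resolve_right (not_not.2 h4)).le

theorem IsWeakRandomMeasure.isTensorGamma [IsProbabilityMeasure P] [IsProbabilityMeasure Q]
    (hQ : IsLocallyAC h P 𝓕 Q) (hγ : IsWeakRandomMeasure h P 𝓕 Q γ) :
    IsTensorGamma h P 𝓕 (tensorMeasure h 𝓕 Q γ) Q γ := by
  rintro X ⟨hX, c, hc⟩
  refine @integral_weightedSum _ _ _ (h.sigma 𝓕) (optionalSigma h 𝓕) _ _ _ _ _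
    (measurable_section_sigma h 𝓕) hγ.adapted.measurable_sigma
    (by simpa only [forall_mem_times_iff] using hγ.nonneg) hγ.hasSum _ hX.measurable_optional c ?_
  refine ae_all_iff.2 fun t => ?_
  have h1 : MeasurableSet[sigmaAt 𝓕 t] {ω | |X t ω| ≤ c} :=
    (continuous_abs.measurable.comp (hX t t.2)) measurableSet_Iic
  exact hQ.ae_eq_zero_or hγ.singular t.2 h1 (by filter_upwards [hc] with ω h using h t t.2)

/-- The measure `Q ⊗ γ` is determined by its expectations. -/
theorem IsTensorGamma.eq {Qbar Qbar' : Measure[optionalSigma h 𝓕] (Ω × h.times)}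
    [IsProbabilityMeasure Qbar] [IsProbabilityMeasure Qbar']
    (hQ : IsTensorGamma h P 𝓕 Qbar Q γ) (hQ' : IsTensorGamma h P 𝓕 Qbar' Q γ) :
    Qbar = Qbar' := by
  classical
  refine @Measure.ext _ (optionalSigma h 𝓕) _ _ fun B hB => ?_
  -- The indicator of `B`, read as an adapted process and set to zero off `𝕋`.
  let X : ℕ∞ → Ω → ℝ := fun t ω => if ht : t ∈ h.times then B.indicator 1 (ω, ⟨t, ht⟩) else 0
  have hXB : (fun p : Ω × h.times => X p.2 p.1) = B.indicator 1 := by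
    ext p
    simp [X]
  have hX : IsBoundedAdapted h P 𝓕 X := by
    refine ⟨fun t ht => ?_, 1, ae_of_all _ fun ω t ht => ?_⟩
    · have h1 : X t = ((fun ω : Ω => (ω, (⟨t, ht⟩ : h.times))) ⁻¹' B).indicator 1 := by
        ext ω
        simp [X, ht, Set.indicator]
      rw [h1]
      exact (@measurable_const ℝ Ω _ (sigmaAt 𝓕 t) 1).indicator (measurable_section_sigmaAt h 𝓕 ⟨t, ht⟩ hB)
    · simp only [X, ht, dif_pos, Set.indicator]
      split_ifs <;> simp
  have h1 := (hQ X hX).2.2.2.trans (hQ' X hX).2.2.2.symm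
  rw [hXB, integral_indicator_one hB, integral_indicator_one hB] at h1
  exact (measureReal_eq_measureReal_iff).1 h1

/-! ### Discounting processes -/

theorem natCast_mem_times_finite {T n : ℕ} : (n : ℕ∞) ∈ (Horizon.finite T).times ↔ n ≤ T := by
  simp [Horizon.times]

theorem measurableSet_tendsto_nat {α : Type*} {m : MeasurableSpace α} {f : ℕ → α → ℝ} {g : α → ℝ}
    (hf : ∀ n, Measurable (f n)) (hg : Measurable g) :
    MeasurableSet {a | Tendsto (fun n => f n a) atTop (𝓝 (g a))} :=
  measurableSet_tendsto_fun hf hg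

/-- `D` is a discounting process with increments `γ`, at the point `ω`. -/
def Discounts (h : Horizon) (γ D : ℕ∞ → Ω → ℝ) (ω : Ω) : Prop :=
  (∀ n : ℕ, ((n + 1 : ℕ) : ℕ∞) ∈ h.times → γ n ω = D n ω - D ((n + 1 : ℕ) : ℕ∞) ω) ∧
    match h with
    | .finite T => D T ω = γ T ω
    | .nat => Tendsto (fun n : ℕ => D n ω) atTop (𝓝 0)
    | .natInf => Tendsto (fun n : ℕ => D n ω) atTop (𝓝 (γ ⊤ ω))

/-- Abel summation. The boundary term is kept because its limit depends on the horizon. -/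
theorem sum_mul_increment (D X : ℕ∞ → Ω → ℝ) (ω : Ω) (n : ℕ) :
    ∑ t ∈ Finset.range (n + 1), D (t : ℕ∞) ω * increment X t ω =
      D n ω * X n ω +
        ∑ t ∈ Finset.range n, (D (t : ℕ∞) ω - D ((t + 1 : ℕ) : ℕ∞) ω) * X t ω := by
  induction n with
  | zero => simp [increment]
  | succ n ih =>
    rw [Finset.sum_range_succ, ih, Finset.sum_range_succ _ n]
    simp only [increment]
    ring

/-- The partial sums telescope to `1 - D_n`. Nonnegativity upgrades their convergence to
unconditional summability. -/
theorem Discounts.hasSum_one {ω : Ω} (hD : Discounts h γ D ω) (hD0 : D 0 ω = 1)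
    (hnonneg : ∀ t ∈ h.times, 0 ≤ γ t ω) : HasSum (fun t : h.times => γ t ω) 1 := by
  have key (n : ℕ) (hn : ∀ k < n, ((k + 1 : ℕ) : ℕ∞) ∈ h.times) :
      ∑ k ∈ Finset.range n, γ k ω = 1 - D n ω := by
    rw [Finset.sum_congr rfl fun k hk => hD.1 k (hn k (Finset.mem_range.1 hk)),
      Finset.sum_range_sub' (fun k : ℕ => D k ω), Nat.cast_zero, hD0]
  cases h with
  | finite T =>
    convert! hasSum_times_finite T fun t => γ t ω using 1
    rw [Finset.sum_range_succ, key T fun k hk => natCast_mem_times_finite.2 hk, ← hD.2,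
      sub_add_cancel]
  | nat =>
    rw [hasSum_times_nat (f := fun t => γ t ω),
      hasSum_iff_tendsto_nat_of_nonneg fun n => hnonneg n (ENat.natCast_ne_top n)]
    simp_rw [fun n => key n fun k _ => ENat.natCast_ne_top _]
    simpa using (tendsto_const_nhds (x := (1 : ℝ))).sub hD.2
  | natInf =>
    rw [hasSum_times_natInf (f := fun t => γ t ω),
      hasSum_iff_tendsto_nat_of_nonneg fun n => hnonneg n (Set.mem_univ _)]
    simp_rw [fun n => key n fun k _ => Set.mem_univ _]
    exact tendsto_const_nhds.sub hD.2

theorem discounts_gammaToDisc {ω : Ω} (hγ : HasSum (fun t : h.times => γ t ω) 1) :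
    Discounts h γ (gammaToDisc γ) ω := by
  have hcoe (n : ℕ) : gammaToDisc γ n ω = 1 - ∑ s ∈ Finset.range n, γ (s : ℕ∞) ω := rfl
  refine ⟨fun n _ => ?_, ?_⟩
  · rw [hcoe, hcoe, Finset.sum_range_succ]
    ring
  · cases h with
    | finite T =>
      have h1 := hγ.unique (hasSum_times_finite T fun t => γ t ω)
      rw [Finset.sum_range_succ] at h1
      simp only [hcoe]
      linarith
    | nat =>
      have h1 := ((hasSum_times_nat (f := fun t => γ t ω)).1 hγ).tendsto_sum_nat
      simpa only [hcoe, sub_self] using (tendsto_const_nhds (x := (1 : ℝ))).sub h1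
    | natInf =>
      have h1 := ((hasSum_times_natInf (f := fun t => γ t ω)).1 hγ).tendsto_sum_nat
      simpa only [hcoe, sub_sub_cancel] using (tendsto_const_nhds (x := (1 : ℝ))).sub h1

/-- The sum against `ΔX` and the series `∑ γ_t X_t` have the same value `Q`-a.s., so the integral
formula for `γ` carries over; only the boundary term needs care. -/
theorem IsWeakRandomMeasure.isTensorDisc [IsProbabilityMeasure P] [IsProbabilityMeasure Q]
    (hQ : IsLocallyAC h P 𝓕 Q) (hγ : IsWeakRandomMeasure h P 𝓕 Q γ)
    (hD : ∀ᵐ ω ∂Q, Discounts h γ D ω) : IsTensorDisc h P 𝓕 (tensorMeasure h 𝓕 Q γ) Q D := by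
  rintro X ⟨hX, hXlim⟩
  obtain ⟨h1, h2, h3, h4⟩ := hγ.isTensorGamma hQ X hX
  refine ⟨h1, _, ?_, h3, h4⟩
  obtain ⟨hXa, c, hc⟩ := hX
  have hbdd : ∀ᵐ ω ∂Q, ∀ n : ℕ, (n : ℕ∞) ∈ h.times → |X n ω| ≤ c := by
    refine ae_all_iff.2 fun n => ?_
    by_cases hn : (n : ℕ∞) ∈ h.times
    · have h5 : MeasurableSet[𝓕 n] {ω | |X n ω| ≤ c} :=
        (continuous_abs.measurable.comp (hXa n hn)) measurableSet_Iic
      filter_upwards [hQ.ae_of_ae hn h5 (by filter_upwards [hc] with ω h using h n hn)] with ω h6 _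
      exact h6
    · exact ae_of_all _ fun ω h6 => absurd h6 hn
  have hparts {ω : Ω} (hDω : Discounts h γ D ω) (n : ℕ)
      (hn : ∀ k < n, ((k + 1 : ℕ) : ℕ∞) ∈ h.times) :
      ∑ t ∈ Finset.range (n + 1), D (t : ℕ∞) ω * increment X t ω =
        D n ω * X n ω + ∑ t ∈ Finset.range n, γ t ω * X t ω := by
    rw [sum_mul_increment]
    congr 1
    exact Finset.sum_congr rfl fun k hk => by rw [hDω.1 k (hn k (Finset.mem_range.1 hk))]
  cases h with
  | finite T =>
    filter_upwards [hD] with ω hDω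
    simp only [HasDiscountedSum]
    rw [(hasSum_times_finite T fun t => γ t ω * X t ω).tsum_eq,
      hparts hDω T fun k hk => natCast_mem_times_finite.2 hk, hDω.2, Finset.sum_range_succ _ T,
      add_comm]
  | nat =>
    filter_upwards [hD, h2, hbdd] with ω hDω hsum hb
    simp only [HasDiscountedSum]
    simp_rw [fun n => hparts hDω n fun k _ => ENat.natCast_ne_top _]
    have h5 := ((hasSum_times_nat (f := fun t => γ t ω * X t ω)).1 hsum.hasSum).tendsto_sum_nat
    have h6 : Tendsto (fun n : ℕ => D n ω * X n ω) atTop (𝓝 0) :=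
      hDω.2.zero_mul_isBoundedUnder_le (isBoundedUnder_of ⟨c, fun n => hb n (ENat.natCast_ne_top n)⟩)
    simpa using h6.add h5
  | natInf =>
    have hconv := hQ.ae_eq_zero_or hγ.singular (t := ⊤) (Set.mem_univ _)
      (p := fun ω => Tendsto (fun n : ℕ => X n ω) atTop (𝓝 (X ⊤ ω)))
      (measurableSet_tendsto_nat (m := ⨆ n, 𝓕 n)
        (fun n => (hXa n (Set.mem_univ _)).mono (le_iSup (fun n => 𝓕 n) n) le_rfl)
        (hXa ⊤ (Set.mem_univ _))) (hXlim (Set.mem_univ _))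
    filter_upwards [hD, h2, hbdd, hconv] with ω hDω hsum hb hcv
    simp only [HasDiscountedSum]
    simp_rw [fun n => hparts hDω n fun k _ => Set.mem_univ _]
    have h5 := ((hasSum_times_natInf (f := fun t => γ t ω * X t ω)).1 hsum.hasSum).tendsto_sum_nat
    have h6 : Tendsto (fun n : ℕ => D n ω * X n ω) atTop (𝓝 (γ ⊤ ω * X ⊤ ω)) := by
      -- Convergence of `X` may fail on the singular part of `Q`, but there `γ_∞ = 0`, so `D_n → 0`
      -- and boundedness of `X` suffices.
      rcases hcv with hcv | hcv
      · have h7 := hDω.2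
        rw [hcv] at h7
        rw [hcv, zero_mul]
        exact h7.zero_mul_isBoundedUnder_le
          (isBoundedUnder_of ⟨c, fun n => hb n (Set.mem_univ _)⟩)
      · exact hDω.2.mul hcv
    simpa using h6.add h5

theorem discToGamma_coe (h : Horizon) (D : ℕ∞ → Ω → ℝ) (n : ℕ) (ω : Ω) [Decidable
    (((n + 1 : ℕ) : ℕ∞) ∈ h.times)] : discToGamma h D n ω =
      D n ω - if ((n + 1 : ℕ) : ℕ∞) ∈ h.times then D ((n + 1 : ℕ) : ℕ∞) ω else 0 := by
  classical
  unfold discToGamma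
  congr 1
  exact if_congr (by simp) (by rw [Nat.cast_add_one]) rfl

theorem discToGamma_top (h : Horizon) (D : ℕ∞ → Ω → ℝ) (ω : Ω) :
    discToGamma h D ⊤ ω = D ⊤ ω := by
  simp [discToGamma]

theorem IsDiscountingProcess.discounts (hD : IsDiscountingProcess h P 𝓕 Q D) :
    ∀ᵐ ω ∂Q, Discounts h (discToGamma h D) D ω := by
  classical
  cases h with
  | finite T =>
    refine ae_of_all _ fun ω => ⟨fun n hn => by rw [discToGamma_coe, if_pos hn], ?_⟩
    simp only
    rw [discToGamma_coe, if_neg, sub_zero]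
    rw [natCast_mem_times_finite]
    omega
  | nat =>
    filter_upwards [hD.limit] with ω hω
    exact ⟨fun n hn => by rw [discToGamma_coe, if_pos hn], hω⟩
  | natInf =>
    filter_upwards [hD.limit] with ω hω
    refine ⟨fun n hn => by rw [discToGamma_coe, if_pos hn], ?_⟩
    simp only
    rwa [discToGamma_top]

theorem mem_times_of_succ {n : ℕ} (hn : ((n + 1 : ℕ) : ℕ∞) ∈ h.times) : (n : ℕ∞) ∈ h.times := by
  cases h with
  | finite T =>
    rw [natCast_mem_times_finite] at hn ⊢
    omega
  | nat => exact ENat.natCast_ne_top n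
  | natInf => exact Set.mem_univ _

theorem IsPredictableProcess.measurable (hD : IsPredictableProcess h 𝓕 D) {n : ℕ}
    (hn : (n : ℕ∞) ∈ h.times) : Measurable[𝓕 n] (D n) := by
  cases n with
  | zero => exact hD.1
  | succ n => exact (hD.2.1 n hn).mono (𝓕.mono n.le_succ) le_rfl

theorem IsPredictableProcess.isAdapted_discToGamma (hD : IsPredictableProcess h 𝓕 D) :
    IsAdapted h 𝓕 (discToGamma h D) := by
  classical
  intro t ht
  induction t using ENat.recTopCoe with
  | top =>
    have : discToGamma h D ⊤ = D ⊤ := funext (discToGamma_top h D)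
    rw [this]
    exact hD.2.2 ht
  | coe n =>
    have h1 := hD.measurable ht
    have : discToGamma h D n =
        fun ω => D n ω - if ((n + 1 : ℕ) : ℕ∞) ∈ h.times then D ((n + 1 : ℕ) : ℕ∞) ω else 0 :=
      funext fun ω => discToGamma_coe h D n ω
    rw [this]
    by_cases hn : ((n + 1 : ℕ) : ℕ∞) ∈ h.times
    · simp only [hn, if_true]
      exact h1.sub (hD.2.1 n hn)
    · simp only [hn, if_false, sub_zero]
      exact h1

/-- `D` is nonnegative only `Q`-a.s., so `γ_T = D_T` or `γ_∞ = D_∞` may be negative with positive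
`P`-probability. This is why the weaker structure, rather than `Γ(Q)`, is the common ground for both
converse statements. -/
theorem IsDiscountingProcess.isWeakRandomMeasure (hQ : IsLocallyAC h P 𝓕 Q)
    (hD : IsDiscountingProcess h P 𝓕 Q D) : IsWeakRandomMeasure h P 𝓕 Q (discToGamma h D) := by
  classical
  have hnonneg : ∀ᵐ ω ∂Q, ∀ t ∈ h.times, 0 ≤ discToGamma h D t ω := by
    have h1 : ∀ᵐ ω ∂Q, ∀ n : ℕ, ((n + 1 : ℕ) : ℕ∞) ∈ h.times →
        D ((n + 1 : ℕ) : ℕ∞) ω ≤ D n ω := by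
      refine ae_all_iff.2 fun n => ?_
      by_cases hn : ((n + 1 : ℕ) : ℕ∞) ∈ h.times
      · have h5 : MeasurableSet[𝓕 n] {ω | D ((n + 1 : ℕ) : ℕ∞) ω ≤ D n ω} :=
          measurableSet_le (hD.predictable.2.1 n hn)
            (hD.predictable.measurable (mem_times_of_succ hn))
        filter_upwards [hQ.ae_of_ae (mem_times_of_succ hn) h5
          (by filter_upwards [hD.antitone] with ω h using h n hn)] with ω h6 _ using h6
      · exact ae_of_all _ fun ω h6 => absurd h6 hn
    filter_upwards [h1, hD.nonneg] with ω h2 h3 t ht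
    induction t using ENat.recTopCoe with
    | top => rw [discToGamma_top]; exact h3 ⊤ ht
    | coe n =>
      rw [discToGamma_coe]
      split_ifs with hn
      · exact sub_nonneg.2 (h2 n hn)
      · rw [sub_zero]; exact h3 n ht
  refine ⟨hD.predictable.isAdapted_discToGamma, hnonneg, ?_, ?_⟩
  · filter_upwards [hD.discounts, hnonneg] with ω h1 h2
    exact h1.hasSum_one (hD.zero ω) h2
  · have : discToGamma h D ⊤ = D ⊤ := funext (discToGamma_top h D)
    rw [this]
    exact hD.singular

/-- Existence and uniqueness of `Q ⊗ γ = Q ⊗ D`. -/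
theorem IsWeakRandomMeasure.existsUnique [IsProbabilityMeasure P] [IsProbabilityMeasure Q]
    {μ : ℕ∞ → Ω → ℝ} (hμ : IsReferenceProcess h P 𝓕 μ) (hQ : IsLocallyAC h P 𝓕 Q)
    (hγ : IsWeakRandomMeasure h P 𝓕 Q γ) (hD : ∀ᵐ ω ∂Q, Discounts h γ D ω) :
    ∃! Qbar : Measure[optionalSigma h 𝓕] (Ω × h.times),
      IsProbabilityMeasure Qbar ∧ Qbar ≪ refMeasure h P 𝓕 μ ∧
        IsTensorGamma h P 𝓕 Qbar Q γ ∧ IsTensorDisc h P 𝓕 Qbar Q D := by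
  refine ⟨tensorMeasure h 𝓕 Q γ, ⟨hγ.isProbabilityMeasure, hγ.absolutelyContinuous hμ hQ,
    hγ.isTensorGamma hQ, hγ.isTensorDisc hQ hD⟩, ?_⟩
  rintro Qbar ⟨h1, -, h2, -⟩
  have := hγ.isProbabilityMeasure
  exact h2.eq (hγ.isTensorGamma hQ)

end

/-! ### Sections of a measure on the optional σ-field -/

theorem tsum_enat (f : ℕ∞ → ℝ≥0∞) : ∑' t, f t = ∑' n : ℕ, f n + f ⊤ := by
  classical
  rw [ENNReal.tsum_eq_add_tsum_ite ⊤, add_comm]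
  congr 1
  rw [← (Nat.cast_injective (R := ℕ∞)).tsum_eq]
  · simp
  · intro t ht
    rw [range_natCast_enat]
    intro h
    simp [h] at ht

/-- The densities of the sections of a measure on the optional σ-field. -/
theorem exists_section_densities {h : Horizon} {P : Measure Ω} [IsProbabilityMeasure P]
    {𝓕 : Filtration ℕ mΩ} {μ : ℕ∞ → Ω → ℝ} (hμ : IsReferenceProcess h P 𝓕 μ)
    {Qbar : Measure[optionalSigma h 𝓕] (Ω × h.times)} [IsProbabilityMeasure Qbar]
    (hQbar : Qbar ≪ refMeasure h P 𝓕 μ) :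
    ∃ g : ℕ∞ → Ω → ℝ≥0∞, (∀ t, Measurable[sigmaAt 𝓕 t] (g t)) ∧
      (∀ t ∉ h.times, ∀ ω, g t ω = 0) ∧ ∫⁻ ω, (∑' n : ℕ, g n ω + g ⊤ ω) ∂P = 1 ∧
      ∀ f : Ω × h.times → ℝ≥0∞, Measurable[optionalSigma h 𝓕] f →
        ∫⁻ p, f p ∂Qbar = ∑' t : h.times, ∫⁻ ω, g t ω * f (ω, t) ∂P := by
  classical
  have hμm (t : h.times) : Measurable (μ t) := (hμ.1 t t.2).mono (sigmaAt_le 𝓕 t) le_rfl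
  have hsec := measurable_section h 𝓕
  have : IsProbabilityMeasure (refMeasure h P 𝓕 μ) :=
    @isProbabilityMeasure_weightedSum _ _ _ mΩ (optionalSigma h 𝓕) _ _ _ _ _ hsec hμm
      (by
        filter_upwards [hμ.2.1] with ω hω t
        exact (hω t t.2).le) hμ.2.2
  let Z : Ω × h.times → ℝ≥0∞ := Qbar.rnDeriv (refMeasure h P 𝓕 μ)
  have hZ : Measurable[optionalSigma h 𝓕] Z := Measure.measurable_rnDeriv _ _
  -- By Fubini the section at `t` has `P`-density `μ_t` times the density of `Q̄` at `(·, t)`. The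
  -- value zero off `𝕋` lets all horizons share sums over `ℕ ∪ {∞}`.
  let g : ℕ∞ → Ω → ℝ≥0∞ := fun t ω =>
    if ht : t ∈ h.times then ENNReal.ofReal (μ t ω) * Z (ω, ⟨t, ht⟩) else 0
  have hg (t : h.times) (ω : Ω) : g t ω = ENNReal.ofReal (μ t ω) * Z (ω, t) := by
    simp [g]
  have hgm (t : ℕ∞) : Measurable[sigmaAt 𝓕 t] (g t) := by
    by_cases ht : t ∈ h.times
    · have : g t = fun ω => ENNReal.ofReal (μ t ω) * Z (ω, ⟨t, ht⟩) := funext fun ω => by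
        simp [g, ht]
      rw [this]
      exact (hμ.1 t ht).ennreal_ofReal.mul (hZ.comp (measurable_section_sigmaAt h 𝓕 ⟨t, ht⟩))
    · have : g t = fun _ => 0 := funext fun ω => by simp [g, ht]
      rw [this]
      exact measurable_const
  have hg0 (t : ℕ∞) (ht : t ∉ h.times) (ω : Ω) : g t ω = 0 := by simp [g, ht]
  have hint (f : Ω × h.times → ℝ≥0∞) (hf : Measurable[optionalSigma h 𝓕] f) :
      ∫⁻ p, f p ∂Qbar = ∑' t : h.times, ∫⁻ ω, g t ω * f (ω, t) ∂P := by
    conv_lhs => rw [← Measure.withDensity_rnDeriv_eq Qbar (refMeasure h P 𝓕 μ) hQbar]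
    rw [lintegral_withDensity_eq_lintegral_mul _ hZ hf, refMeasure_eq_weightedSum,
      @lintegral_weightedSum _ _ _ mΩ (optionalSigma h 𝓕) _ _ _ hsec hμm _ (hZ.mul hf)]
    congr with t
    congr with ω
    rw [Pi.mul_apply, hg, mul_assoc]
  refine ⟨g, hgm, hg0, ?_, hint⟩
  have h1 := hint (fun _ => 1) measurable_const
  simp only [lintegral_const, measure_univ, mul_one] at h1
  have h2 (ω : Ω) : ∑' n : ℕ, g n ω + g ⊤ ω = ∑' t, g t ω := (tsum_enat fun t => g t ω).symm
  simp_rw [h2]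
  rw [lintegral_tsum fun t => ((hgm t).mono (sigmaAt_le 𝓕 t) le_rfl).aemeasurable, h1]
  refine ((Subtype.val_injective (p := fun t => t ∈ h.times)).tsum_eq
    (f := fun t => ∫⁻ ω, g t ω ∂P) fun t ht => ?_).symm
  by_contra hth
  refine ht ?_
  have hth' : t ∉ h.times := fun h' => hth ⟨⟨t, h'⟩, rfl⟩
  simp [hg0 t hth']

/-! ### Existence of the decomposition -/

/-- Change of measure on a sub-σ-field. -/
theorem setLIntegral_eq_setLIntegral_mul_density {Ω : Type*} {m m₁ mΩ : MeasurableSpace Ω}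
    (hm₁ : m ≤ m₁) (hm : m ≤ mΩ) {Q : Measure[m₁] Ω} {P : Measure Ω} {M f : Ω → ℝ≥0∞}
    (hM : Measurable M) (hQ : ∀ A, MeasurableSet[m] A → Q A = ∫⁻ ω in A, M ω ∂P)
    (hf : Measurable[m] f) {A : Set Ω} (hA : MeasurableSet[m] A) :
    ∫⁻ ω in A, f ω ∂Q = ∫⁻ ω in A, M ω * f ω ∂P := by
  have h1 : Q.trim hm₁ = (P.withDensity M).trim hm := by
    refine @Measure.ext _ m _ _ fun B hB => ?_
    rw [trim_measurableSet_eq hm₁ hB, trim_measurableSet_eq hm hB, withDensity_apply _ (hm B hB),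
      hQ B hB]
  rw [← setLIntegral_trim hm₁ hf hA, h1, setLIntegral_trim hm hf hA,
    setLIntegral_withDensity_eq_setLIntegral_mul _ hM (hf.mono hm le_rfl) (hm A hA)]
  rfl

/-- A martingale of densities determines a measure in `𝓜_loc(P)`. -/
theorem exists_measure_of_martingale {h : Horizon} {P : Measure Ω} [IsProbabilityMeasure P]
    {𝓕 : Filtration ℕ mΩ} (h𝓕 : h.IsInfinite → IsStandardFiltration 𝓕) {M : ℕ → Ω → ℝ≥0∞}
    (hM0 : ∀ ω, M 0 ω = 1)
    (hMm : ∀ n A, MeasurableSet[𝓕 n] A → ∫⁻ ω in A, M (n + 1) ω ∂P = ∫⁻ ω in A, M n ω ∂P) :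
    ∃ Q : Measure[h.sigma 𝓕] Ω, IsProbabilityMeasure Q ∧
      ∀ n : ℕ, (n : ℕ∞) ∈ h.times → ∀ A, MeasurableSet[𝓕 n] A → Q A = ∫⁻ ω in A, M n ω ∂P := by
  have hle {n k : ℕ} (hnk : n ≤ k) (A : Set Ω) (hA : MeasurableSet[𝓕 n] A) :
      ∫⁻ ω in A, M k ω ∂P = ∫⁻ ω in A, M n ω ∂P := by
    induction k, hnk using Nat.le_induction with
    | base => rfl
    | succ k hnk ih => rw [hMm k A (𝓕.mono hnk A hA), ih]
  have hone (n : ℕ) : ∫⁻ ω, M n ω ∂P = 1 := by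
    have := hle n.zero_le Set.univ MeasurableSet.univ
    simpa [hM0] using this
  have hprob (n : ℕ) : IsProbabilityMeasure (P.withDensity (M n)) :=
    ⟨by rw [withDensity_apply _ MeasurableSet.univ, Measure.restrict_univ, hone n]⟩
  -- Standardness is needed only here; for a finite horizon `M T` is itself the density of `Q`.
  have hinf (hh : h.IsInfinite) : ∃ R : Measure[⨆ n, 𝓕 n] Ω, IsProbabilityMeasure R ∧
      ∀ n A, MeasurableSet[𝓕 n] A → R A = ∫⁻ ω in A, M n ω ∂P := by
    obtain ⟨R, hR, hRM⟩ := (h𝓕 hh).exists_extension (fun n => P.withDensity (M n))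
      fun n A hA => by
        rw [withDensity_apply _ (𝓕.le n A hA), withDensity_apply _ (𝓕.le n A hA), hMm n A hA]
    exact ⟨R, hR, fun n A hA => by rw [hRM n A hA, withDensity_apply _ (𝓕.le n A hA)]⟩
  cases h with
  | finite T =>
    refine ⟨(P.withDensity (M T)).trim (𝓕.le T),
      ⟨by rw [trim_measurableSet_eq (𝓕.le T) (@MeasurableSet.univ _ (𝓕 T)), measure_univ]⟩,
      fun n hn A hA => ?_⟩
    have hnT := natCast_mem_times_finite.1 hn
    rw [trim_measurableSet_eq (𝓕.le T) (𝓕.mono hnT A hA), withDensity_apply _ (𝓕.le n A hA),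
      hle hnT A hA]
  | nat =>
    obtain ⟨R, hR, hRM⟩ := hinf trivial
    exact ⟨R, hR, fun n _ => hRM n⟩
  | natInf =>
    obtain ⟨R, hR, hRM⟩ := hinf trivial
    exact ⟨R, hR, fun n _ => hRM n⟩

/-- The limit of the discounting process is the density of the mass at infinity. -/
theorem setLIntegral_iInf_eq {P : Measure Ω} [IsProbabilityMeasure P] {𝓕 : Filtration ℕ mΩ}
    {Q : Measure[⨆ n, 𝓕 n] Ω} [IsProbabilityMeasure Q] {D G : ℕ → Ω → ℝ≥0∞} {g : Ω → ℝ≥0∞}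
    (hDm : ∀ n, Measurable[𝓕 n] (D n)) (hD1 : ∀ n ω, D n ω ≤ 1)
    (hDanti : ∀ n ω, D (n + 1) ω ≤ D n ω) (hGm : ∀ n, Measurable (G n))
    (hGanti : ∀ n ω, G n ω ≤ G 0 ω) (hG0 : ∫⁻ ω, G 0 ω ∂P ≠ ∞)
    (hGlim : ∀ᵐ ω ∂P, Tendsto (fun n => G n ω) atTop (𝓝 (g ω)))
    (hDG : ∀ n A, MeasurableSet[𝓕 n] A → ∫⁻ ω in A, D n ω ∂Q = ∫⁻ ω in A, G n ω ∂P)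
    {A : Set Ω} (hA : MeasurableSet[⨆ n, 𝓕 n] A) :
    ∫⁻ ω in A, ⨅ n, D n ω ∂Q = ∫⁻ ω in A, g ω ∂P := by
  have hle : (⨆ n, 𝓕 n) ≤ mΩ := iSup_le fun n => 𝓕.le n
  have hDm' (n : ℕ) : Measurable[⨆ n, 𝓕 n] (D n) :=
    (hDm n).mono (le_iSup (fun n => 𝓕 n) n) le_rfl
  -- For `n ≥ k` the integrals of `D n` and `G n` over `B` agree; dominated convergence passes to
  -- the limit on both sides, and the π-system `⋃ 𝓕 k` then gives all of `𝓕_∞`.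
  have key (B : Set Ω) (k : ℕ) (hB : MeasurableSet[𝓕 k] B) :
      ∫⁻ ω in B, ⨅ n, D n ω ∂Q = ∫⁻ ω in B, g ω ∂P := by
    have h1 : Tendsto (fun n => ∫⁻ ω in B, D n ω ∂Q) atTop (𝓝 (∫⁻ ω in B, ⨅ n, D n ω ∂Q)) :=
      @tendsto_lintegral_of_dominated_convergence Ω (⨆ n, 𝓕 n) (Q.restrict B) _ _ (fun _ => 1) hDm'
        (fun n => ae_of_all _ (hD1 n)) (by simp)
        (ae_of_all _ fun ω => tendsto_atTop_iInf (antitone_nat_of_succ_le fun n => hDanti n ω))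
    have h2 : Tendsto (fun n => ∫⁻ ω in B, G n ω ∂P) atTop (𝓝 (∫⁻ ω in B, g ω ∂P)) :=
      tendsto_lintegral_of_dominated_convergence (G 0) hGm (fun n => ae_of_all _ (hGanti n))
        (((setLIntegral_le_lintegral _ _).trans_lt (lt_top_iff_ne_top.2 hG0)).ne)
        (ae_restrict_of_ae hGlim)
    refine tendsto_nhds_unique (h1.congr' ?_) h2
    filter_upwards [eventually_ge_atTop k] with n hn
    exact hDG n B (𝓕.mono hn B hB)
  have hμν : Q.withDensity (fun ω => ⨅ n, D n ω) = (P.withDensity g).trim hle := by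
    have hfin : IsFiniteMeasure (Q.withDensity fun ω => ⨅ n, D n ω) := by
      refine isFiniteMeasure_withDensity ?_
      refine ((lintegral_mono (g := fun _ => 1) fun ω => (iInf_le _ 0).trans (hD1 0 ω)).trans_lt
        ?_).ne
      simp
    have heq (B : Set Ω) (hB : ∃ k, MeasurableSet[𝓕 k] B) :
        Q.withDensity (fun ω => ⨅ n, D n ω) B = (P.withDensity g).trim hle B := by
      obtain ⟨k, hB⟩ := hB
      have hB' : MeasurableSet[⨆ n, 𝓕 n] B := le_iSup (fun n => 𝓕 n) k B hB
      rw [withDensity_apply _ hB', trim_measurableSet_eq hle hB', withDensity_apply _ (hle B hB'),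
        key B k hB]
    refine ext_of_generate_finite _ (iSup_filtration_eq_generateFrom 𝓕) ?_ heq
      (heq _ ⟨0, @MeasurableSet.univ _ (𝓕 0)⟩)
    intro B hB C hC _
    exact (isSetAlgebra_iUnion_filtration 𝓕).inter_mem hB hC
  rw [← withDensity_apply _ hA, hμν, trim_measurableSet_eq hle hA, withDensity_apply _ (hle A hA)]

/-- The real process associated with a decreasing sequence of `[0, ∞]`-valued functions. -/
def discountOfSeq (D : ℕ → Ω → ℝ≥0∞) (t : ℕ∞) (ω : Ω) : ℝ :=
  ENat.recTopCoe (⨅ n, D n ω).toReal (fun n => (D n ω).toReal) t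

/-- The set `{M_∞ = ∞}` is `P`-null, so integrating `D_∞ Q = g P` over it gives zero. -/
theorem vanishesOnSingular_discountOfSeq {h : Horizon} {P : Measure Ω} [IsProbabilityMeasure P]
    {𝓕 : Filtration ℕ mΩ} {Q : Measure[h.sigma 𝓕] Ω} [IsProbabilityMeasure Q]
    (hQ : IsLocallyAC h P 𝓕 Q) {g : Ω → ℝ≥0∞} {D : ℕ → Ω → ℝ≥0∞}
    (hDm : ∀ n, Measurable[𝓕 n] (D n))
    (hDg : h.IsInfinite → ∀ A, MeasurableSet[⨆ n, 𝓕 n] A →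
      ∫⁻ ω in A, ⨅ n, D n ω ∂Q = ∫⁻ ω in A, g ω ∂P) :
    VanishesOnSingular h P 𝓕 Q (discountOfSeq D ⊤) := by
  cases h with
  | finite T => trivial
  | nat => trivial
  | natInf =>
    have hQ' : ∀ n A, MeasurableSet[𝓕 n] A → P A = 0 → Q A = 0 :=
      fun n A hA => hQ n (Set.mem_univ _) A hA
    have hS : MeasurableSet[⨆ n, 𝓕 n] (limitDensity P 𝓕 Q ⁻¹' {∞}) :=
      measurable_limitDensity (measurableSet_singleton _)
    have hPS : P (limitDensity P 𝓕 Q ⁻¹' {∞}) = 0 := by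
      rw [measure_eq_zero_iff_ae_notMem]
      filter_upwards [limitDensity_lt_top hQ'] with ω hω using hω.ne
    have h1 := hDg trivial _ hS
    rw [Measure.restrict_eq_zero.2 hPS, lintegral_zero_measure, lintegral_eq_zero_iff
      (Measurable.iInf fun n => (hDm n).mono (le_iSup (fun n => 𝓕 n) n) le_rfl)] at h1
    filter_upwards [(ae_restrict_iff' hS).1 h1] with ω h2 h3
    change (⨅ n, D n ω).toReal = 0
    rw [h2 h3]
    rfl

/-- For `𝕋 = ℕ₀` the density `g_∞` is zero, so `D_∞ Q = g_∞ P` forces the decreasing limit of `D` to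
vanish `Q`-a.s. -/
theorem hasDiscountLimit_discountOfSeq {h : Horizon} {P : Measure Ω}
    {𝓕 : Filtration ℕ mΩ} {Q : Measure[h.sigma 𝓕] Ω} {g : ℕ∞ → Ω → ℝ≥0∞}
    (hg : ∀ t ∉ h.times, ∀ ω, g t ω = 0) {D : ℕ → Ω → ℝ≥0∞}
    (hDm : ∀ n, Measurable[𝓕 n] (D n)) (hD1 : ∀ n ω, D n ω ≤ 1)
    (hDanti : ∀ n ω, D (n + 1) ω ≤ D n ω)
    (hDg : h.IsInfinite → ∀ A, MeasurableSet[⨆ n, 𝓕 n] A →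
      ∫⁻ ω in A, ⨅ n, D n ω ∂Q = ∫⁻ ω in A, g ⊤ ω ∂P) :
    HasDiscountLimit h 𝓕 Q (discountOfSeq D) := by
  have hlim (ω : Ω) : Tendsto (fun n : ℕ => discountOfSeq D n ω) atTop
      (𝓝 (⨅ n, D n ω).toReal) := by
    refine (ENNReal.tendsto_toReal ?_).comp
      (tendsto_atTop_iInf (antitone_nat_of_succ_le fun n => hDanti n ω))
    exact (((iInf_le _ 0).trans (hD1 0 ω)).trans_lt ENNReal.one_lt_top).ne
  cases h with
  | finite T => trivial
  | nat =>
    have h1 := hDg trivial Set.univ (@MeasurableSet.univ _ (⨆ n, 𝓕 n))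
    have h2 : ⊤ ∉ Horizon.nat.times := by simp [Horizon.times]
    simp only [hg ⊤ h2, Measure.restrict_univ, lintegral_zero] at h1
    rw [lintegral_eq_zero_iff
      (Measurable.iInf fun n => (hDm n).mono (le_iSup (fun n => 𝓕 n) n) le_rfl)] at h1
    filter_upwards [h1] with ω hω
    have h3 := hlim ω
    rw [hω] at h3
    exact h3
  | natInf => exact ae_of_all _ hlim

/-- Existence of `Q` and `D` for given densities `g` of the sections. -/
theorem exists_isDiscountingProcess {h : Horizon} {P : Measure Ω} [IsProbabilityMeasure P]
    {𝓕 : Filtration ℕ mΩ} (h𝓕₀ : 𝓕 0 = ⊥) (h𝓕 : h.IsInfinite → IsStandardFiltration 𝓕)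
    {g : ℕ∞ → Ω → ℝ≥0∞} (hgm : ∀ t, Measurable[sigmaAt 𝓕 t] (g t))
    (hg : ∀ t ∉ h.times, ∀ ω, g t ω = 0) (hg1 : ∫⁻ ω, (∑' n : ℕ, g n ω + g ⊤ ω) ∂P = 1) :
    ∃ (Q : Measure[h.sigma 𝓕] Ω) (D : ℕ∞ → Ω → ℝ),
      IsProbabilityMeasure Q ∧ IsLocallyAC h P 𝓕 Q ∧ IsDiscountingProcess h P 𝓕 Q D ∧
      (∀ t ω, 0 ≤ D t ω) ∧ (∀ t ∈ h.times, ∀ ω, 0 ≤ discToGamma h D t ω) ∧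
      ∀ t ∈ h.times, ∀ A, MeasurableSet[sigmaAt 𝓕 t] A →
        ∫⁻ ω in A, ENNReal.ofReal (discToGamma h D t ω) ∂Q = ∫⁻ ω in A, g t ω ∂P := by
  classical
  have hgm' (t : ℕ∞) : Measurable (g t) := (hgm t).mono (sigmaAt_le 𝓕 t) le_rfl
  -- The mass from time `n` on, including the mass at `∞`, which thus survives in every tail.
  let G : ℕ → Ω → ℝ≥0∞ := fun n ω => ∑' k : ℕ, g ((k + n : ℕ) : ℕ∞) ω + g ⊤ ω
  have hG (n : ℕ) (ω : Ω) : G n ω = g n ω + G (n + 1) ω := by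
    simp only [G]
    rw [tsum_eq_zero_add' ENNReal.summable, zero_add, add_assoc]
    simp only [add_assoc, add_comm 1 n]
  have hGm (n : ℕ) : Measurable (G n) :=
    (Measurable.tsum fun k => hgm' _).add (hgm' _)
  obtain ⟨M, D, hMm, hM0, hMmart, hDp, hD0, hDanti, hMD, hMDG⟩ :=
    exists_multiplicative_decomposition (P := P) h𝓕₀ (g := fun n => g n) (fun n => hgm n) hG
      (by simpa only [G, add_zero] using hg1)
  obtain ⟨Q, hQprob, hQM⟩ := exists_measure_of_martingale h𝓕 hM0 hMmart
  have hD1 (n : ℕ) (ω : Ω) : D n ω ≤ 1 := by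
    induction n with
    | zero => exact (hD0 ω).le
    | succ n ih => exact (hDanti n ω).trans ih
  have hDtop (n : ℕ) (ω : Ω) : D n ω ≠ ∞ := ((hD1 n ω).trans_lt ENNReal.one_lt_top).ne
  have hDm (n : ℕ) : Measurable[𝓕 n] (D n) := by
    cases n with
    | zero =>
      have : D 0 = fun _ => 1 := funext hD0
      rw [this]
      exact measurable_const
    | succ n => exact (hDp n).mono (𝓕.mono n.le_succ) le_rfl
  have hQac : IsLocallyAC h P 𝓕 Q := by
    intro n hn A hA hPA
    rw [hQM n hn A hA, Measure.restrict_eq_zero.2 hPA, lintegral_zero_measure]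
  have hQint {n : ℕ} (hn : (n : ℕ∞) ∈ h.times) {f : Ω → ℝ≥0∞} (hf : Measurable[𝓕 n] f)
      {A : Set Ω} (hA : MeasurableSet[𝓕 n] A) :
      ∫⁻ ω in A, f ω ∂Q = ∫⁻ ω in A, M n ω * f ω ∂P :=
    setLIntegral_eq_setLIntegral_mul_density (sigmaAt_le_sigma 𝓕 hn) (𝓕.le n)
      ((hMm n).mono (𝓕.le n) le_rfl) (hQM n hn) hf hA
  have hDG {n : ℕ} (hn : (n : ℕ∞) ∈ h.times) (A : Set Ω) (hA : MeasurableSet[𝓕 n] A) :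
      ∫⁻ ω in A, D n ω ∂Q = ∫⁻ ω in A, G n ω ∂P := by
    rw [hQint hn (hDm n) hA, hMDG n A hA]
  have hGle (n : ℕ) (ω : Ω) : G n ω ≤ G 0 ω := by
    induction n with
    | zero => rfl
    | succ n ih => exact le_trans (by rw [hG n]; exact le_add_self) ih
  have hG0 : ∫⁻ ω, G 0 ω ∂P = 1 := by simpa only [G, add_zero] using hg1
  have hGlim : ∀ᵐ ω ∂P, Tendsto (fun n => G n ω) atTop (𝓝 (g ⊤ ω)) := by
    filter_upwards [ae_lt_top (hGm 0) (by rw [hG0]; exact ENNReal.one_ne_top)] with ω hω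
    have h1 : ∑' k : ℕ, g k ω ≠ ∞ := by
      intro h2
      simp [G, h2] at hω
    simpa only [zero_add] using
      (ENNReal.tendsto_sum_nat_add (fun k => g k ω) h1).add_const (g ⊤ ω)
  have hDg : h.IsInfinite → ∀ A, MeasurableSet[⨆ n, 𝓕 n] A →
      ∫⁻ ω in A, ⨅ n, D n ω ∂Q = ∫⁻ ω in A, g ⊤ ω ∂P := by
    intro hh A hA
    have hG0' : ∫⁻ ω, G 0 ω ∂P ≠ ∞ := by rw [hG0]; exact ENNReal.one_ne_top
    cases h with
    | finite T => exact hh.elim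
    | nat =>
      exact setLIntegral_iInf_eq hDm hD1 hDanti hGm hGle hG0' hGlim
        (fun n A hA => hDG (ENat.natCast_ne_top n) A hA) hA
    | natInf =>
      exact setLIntegral_iInf_eq hDm hD1 hDanti hGm hGle hG0' hGlim
        (fun n A hA => hDG (Set.mem_univ _) A hA) hA
  have hcoe (n : ℕ) (ω : Ω) : discountOfSeq D n ω = (D n ω).toReal := rfl
  have htop (ω : Ω) : discountOfSeq D ⊤ ω = (⨅ n, D n ω).toReal := rfl
  have hnonneg (t : ℕ∞) (ω : Ω) : 0 ≤ discountOfSeq D t ω := by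
    induction t using ENat.recTopCoe with
    | top => exact ENNReal.toReal_nonneg
    | coe n => exact ENNReal.toReal_nonneg
  have hanti (n : ℕ) (ω : Ω) : discountOfSeq D ((n + 1 : ℕ) : ℕ∞) ω ≤ discountOfSeq D n ω :=
    ENNReal.toReal_mono (hDtop n ω) (hDanti n ω)
  refine ⟨Q, discountOfSeq D, hQprob, hQac, ?_, hnonneg, ?_, ?_⟩
  · refine ⟨⟨?_, fun n _ => (hDp n).ennreal_toReal, fun _ => ?_⟩, fun ω => ?_,
      ae_of_all _ fun ω n _ => hanti n ω, ae_of_all _ fun ω t _ => hnonneg t ω,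
      hasDiscountLimit_discountOfSeq hg hDm hD1 hDanti hDg,
      vanishesOnSingular_discountOfSeq hQac hDm hDg⟩
    · exact (hDm 0).ennreal_toReal
    · exact (Measurable.iInf fun n =>
        (hDm n).mono (le_iSup (fun n => 𝓕 n) n) le_rfl).ennreal_toReal
    · change (D 0 ω).toReal = 1
      rw [hD0, ENNReal.toReal_one]
  · intro t ht ω
    induction t using ENat.recTopCoe with
    | top => rw [discToGamma_top]; exact hnonneg _ ω
    | coe n =>
      rw [discToGamma_coe]
      split_ifs
      · exact sub_nonneg.2 (hanti n ω)
      · rw [sub_zero]; exact hnonneg _ ω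
  · intro t ht A hA
    induction t using ENat.recTopCoe with
    | top =>
      have hh : h.IsInfinite := by
        cases h with
        | finite T => simp [Horizon.times] at ht
        | nat => trivial
        | natInf => trivial
      rw [← hDg hh A hA]
      congr with ω
      rw [discToGamma_top, htop, ENNReal.ofReal_toReal]
      exact (((iInf_le _ 0).trans (hD1 0 ω)).trans_lt ENNReal.one_lt_top).ne
    | coe n =>
      have hA' : MeasurableSet[𝓕 n] A := hA
      by_cases hn : ((n + 1 : ℕ) : ℕ∞) ∈ h.times
      · have h1 (ω : Ω) : ENNReal.ofReal (discToGamma h (discountOfSeq D) n ω) =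
            D n ω - D (n + 1) ω := by
          rw [discToGamma_coe, if_pos hn, hcoe, hcoe,
            ← ENNReal.toReal_sub_of_le (hDanti n ω) (hDtop n ω), ENNReal.ofReal_toReal]
          exact ENNReal.sub_ne_top (hDtop n ω)
        simp_rw [h1]
        rw [hQint ht (f := fun ω => D n ω - D (n + 1) ω) ((hDm n).sub (hDp n)) hA']
        have hMfin : ∀ᵐ ω ∂P, M n ω < ∞ := by
          refine ae_lt_top ((hMm n).mono (𝓕.le n) le_rfl) ?_
          have h2 := hQM n ht Set.univ MeasurableSet.univ
          rw [measure_univ, Measure.restrict_univ] at h2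
          rw [← h2]
          exact ENNReal.one_ne_top
        -- This is `M_n (D_n - D_{n+1}) = g_n`; the subtraction is legitimate because `M_n D_{n+1}`
        -- is finite a.s.
        refine lintegral_congr_ae (ae_restrict_of_ae ?_)
        filter_upwards [hMD n, hMfin] with ω h2 h3
        rw [ENNReal.mul_sub fun _ _ => h3.ne, h2, ENNReal.add_sub_cancel_right]
        exact ENNReal.mul_ne_top h3.ne (hDtop _ ω)
      · have h1 (ω : Ω) : ENNReal.ofReal (discToGamma h (discountOfSeq D) n ω) = D n ω := by
          rw [discToGamma_coe, if_neg hn, sub_zero, hcoe, ENNReal.ofReal_toReal (hDtop n ω)]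
        -- Here `n = T`, and `γ_T` is all of `D_T`. No mass lies beyond `T`, so `G (T + 1) = 0` and
        -- `G T = g T`.
        have h2 (k : ℕ) : ((k + (n + 1) : ℕ) : ℕ∞) ∉ h.times ∧ ⊤ ∉ h.times := by
          cases h with
          | finite T =>
            rw [natCast_mem_times_finite] at hn ⊢
            exact ⟨by omega, by simp [Horizon.times]⟩
          | nat => exact absurd (ENat.natCast_ne_top _) hn
          | natInf => exact absurd (Set.mem_univ _) hn
        simp_rw [h1]
        rw [hDG ht A hA']
        congr with ω
        rw [hG]
        simp only [G, fun k => hg _ (h2 k).1 ω, hg _ (h2 0).2 ω, tsum_zero, add_zero]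

/-- Measures on the optional σ-field with the same sections agree. -/
theorem tensorMeasure_eq {h : Horizon} {P : Measure Ω} {𝓕 : Filtration ℕ mΩ}
    {Q : Measure[h.sigma 𝓕] Ω} {γ : ℕ∞ → Ω → ℝ} (hγ : IsAdapted h 𝓕 γ) {g : ℕ∞ → Ω → ℝ≥0∞}
    {Qbar : Measure[optionalSigma h 𝓕] (Ω × h.times)}
    (hQbar : ∀ f : Ω × h.times → ℝ≥0∞, Measurable[optionalSigma h 𝓕] f →
      ∫⁻ p, f p ∂Qbar = ∑' t : h.times, ∫⁻ ω, g t ω * f (ω, t) ∂P)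
    (hγg : ∀ t ∈ h.times, ∀ A, MeasurableSet[sigmaAt 𝓕 t] A →
      ∫⁻ ω in A, ENNReal.ofReal (γ t ω) ∂Q = ∫⁻ ω in A, g t ω ∂P) :
    tensorMeasure h 𝓕 Q γ = Qbar := by
  refine @Measure.ext _ (optionalSigma h 𝓕) _ _ fun B hB => ?_
  have hf : Measurable[optionalSigma h 𝓕] (B.indicator fun _ => (1 : ℝ≥0∞)) :=
    (@measurable_const _ _ _ (optionalSigma h 𝓕) 1).indicator hB
  have hind (ν : Measure[optionalSigma h 𝓕] (Ω × h.times)) :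
      ν B = ∫⁻ p, B.indicator (fun _ => 1) p ∂ν := by
    rw [lintegral_indicator hB, setLIntegral_one]
  rw [hind, hind, hQbar _ hf, tensorMeasure, @lintegral_weightedSum _ _ _ (h.sigma 𝓕)
    (optionalSigma h 𝓕) _ _ _ (measurable_section_sigma h 𝓕) hγ.measurable_sigma _ hf]
  congr with t
  have hBt : MeasurableSet[sigmaAt 𝓕 t] ((fun ω => (ω, t)) ⁻¹' B) :=
    measurable_section_sigmaAt h 𝓕 t hB
  have key (f : Ω → ℝ≥0∞) (ω : Ω) : f ω * B.indicator (fun _ => 1) (ω, t) =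
      ((fun ω => (ω, t)) ⁻¹' B).indicator f ω := by
    by_cases hω : (ω, t) ∈ B
    · simp [Set.indicator, hω]
    · simp [Set.indicator, hω]
  simp_rw [key (fun ω => ENNReal.ofReal (γ t ω)), key (g t)]
  rw [lintegral_indicator (sigmaAt_le_sigma 𝓕 t.2 _ hBt), lintegral_indicator
    (sigmaAt_le 𝓕 t _ hBt), hγg t t.2 _ hBt]

end OptionalDecomposition

end

theorem theorem3p2 {Ω : Type*} {mΩ : MeasurableSpace Ω} (h : Horizon)
    (P : Measure Ω) [IsProbabilityMeasure P] (𝓕 : Filtration ℕ mΩ) (h𝓕₀ : 𝓕 0 = ⊥)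
    (h𝓕 : h.IsInfinite → IsStandardFiltration 𝓕)
    (μ : ℕ∞ → Ω → ℝ) (hμ : IsReferenceProcess h P 𝓕 μ) :
    -- every `Q̄ ∈ 𝓜(P̄)` has a decomposition `Q̄ = Q ⊗ γ = Q ⊗ D`
    (∀ Qbar : Measure[optionalSigma h 𝓕] (Ω × h.times), IsProbabilityMeasure Qbar →
      Qbar ≪ refMeasure h P 𝓕 μ →
      ∃ (Q : Measure[h.sigma 𝓕] Ω) (γ D : ℕ∞ → Ω → ℝ),
        IsProbabilityMeasure Q ∧ IsLocallyAC h P 𝓕 Q ∧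
        IsOptionalRandomMeasure h P 𝓕 Q γ ∧ IsDiscountingProcess h P 𝓕 Q D ∧
        (∀ᵐ ω ∂P, ∀ t ∈ h.times, 0 ≤ D t ω) ∧
        (∀ t ∈ h.times, ∀ ω, γ t ω = discToGamma h D t ω) ∧
        IsTensorGamma h P 𝓕 Qbar Q γ ∧ IsTensorDisc h P 𝓕 Qbar Q D) ∧
    -- every `Q ∈ 𝓜_loc(P)` and `γ ∈ Γ(Q)` define a measure in `𝓜(P̄)`
    (∀ (Q : Measure[h.sigma 𝓕] Ω) (γ : ℕ∞ → Ω → ℝ), IsProbabilityMeasure Q →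
      IsLocallyAC h P 𝓕 Q → IsOptionalRandomMeasure h P 𝓕 Q γ →
      ∃! Qbar : Measure[optionalSigma h 𝓕] (Ω × h.times),
        IsProbabilityMeasure Qbar ∧ Qbar ≪ refMeasure h P 𝓕 μ ∧
        IsTensorGamma h P 𝓕 Qbar Q γ ∧ IsTensorDisc h P 𝓕 Qbar Q (gammaToDisc γ)) ∧
    -- every `Q ∈ 𝓜_loc(P)` and `D ∈ 𝓓(Q)` define a measure in `𝓜(P̄)`
    (∀ (Q : Measure[h.sigma 𝓕] Ω) (D : ℕ∞ → Ω → ℝ), IsProbabilityMeasure Q →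
      IsLocallyAC h P 𝓕 Q → IsDiscountingProcess h P 𝓕 Q D →
      ∃! Qbar : Measure[optionalSigma h 𝓕] (Ω × h.times),
        IsProbabilityMeasure Qbar ∧ Qbar ≪ refMeasure h P 𝓕 μ ∧
        IsTensorGamma h P 𝓕 Qbar Q (discToGamma h D) ∧ IsTensorDisc h P 𝓕 Qbar Q D) := by
  refine ⟨?_, ?_, ?_⟩
  · intro Qbar hQbar hac
    obtain ⟨g, hgm, hg, hg1, hint⟩ := exists_section_densities hμ hac
    obtain ⟨Q, D, hQ, hQP, hD, hD0, hγ0, hγg⟩ := exists_isDiscountingProcess h𝓕₀ h𝓕 hgm hg hg1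
    have hγ := hD.isWeakRandomMeasure hQP
    -- Equality of sections identifies `Q̄` with `Q ⊗ γ`, so both representations follow from the
    -- converse direction.
    obtain rfl := tensorMeasure_eq hγ.adapted hint hγg
    exact ⟨Q, discToGamma h D, D, hQ, hQP,
      ⟨hγ.adapted, ae_of_all _ fun ω t ht => hγ0 t ht ω, hγ.hasSum, hγ.singular⟩, hD,
      ae_of_all _ fun ω t _ => hD0 t ω, fun _ _ _ => rfl, hγ.isTensorGamma hQP,
      hγ.isTensorDisc hQP hD.discounts⟩
  · intro Q γ hQ hQP hγ
    have hγ' := hγ.isWeakRandomMeasure hQP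
    refine hγ'.existsUnique hμ hQP ?_
    filter_upwards [hγ'.hasSum] with ω hω using discounts_gammaToDisc hω
  · intro Q D hQ hQP hD
    exact (hD.isWeakRandomMeasure hQP).existsUnique hμ hQP hD.discounts
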